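/- Let $\tau\in\mathbb C$ with $\operatorname{Im}\tau>0$, $q=e^{\pi i\tau}$, $q^s:=e^{\pi i\tau s}$ $(s\in\mathbb C)$, $\Lambda=\mathbb Z\tau+\mathbb Z$, $\vartheta(z)=\sum_{\nu\in\mathbb Z+1/2}e^{2\pi i\nu(z+1/2)+\pi i\nu^2\tau}$, and let $$\mu(u,v;\alpha)=\frac{e^{\pi i\alpha(u-v)}}{\vartheta(v)}\sum_{n\in\mathbb Z}(-1)^ne^{2\pi i(n+\frac12)v}e^{\pi in(n+1)\tau}\prod_{j=1}^\infty\frac{1-e^{2\pi iu+2\pi i(n+j)\tau}}{1-e^{2\pi iu+2\pi i(n-\alpha+j)\tau}}$$ be the Shibukawa–Tsuchimi one-parameter extension of Zwegers' $\mu$-function. For $u,m,k\in\mathbb C$ and an integer $n\ge-1$ put $\xi_{m,n,k}=\xi_{m,n,k}(u)=\det[\mu(u+v+k\tau,v;m-j-j')]_{j,j'=0}^{n}$ (so $\xi_{m,-1,k}=1$). The $(A_2+A_1)^{(1)}$ $q$-Painlevé equation for $(x,a_1,a_2;f_1,f_2)$ consists, with $a_0a_1a_2=q$, $f_0f_1f_2=x^2q$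 and indices modulo $3$, of $T(x,a_1,a_2)=(xq,a_1,a_2)$, $T_1(x,a_1,a_2)=(x,a_1q,a_2)$, $T_2(x,a_1,a_2)=(x,a_1,a_2q)$ and $$T(f_j)=a_ja_{j+1}f_{j+1}\frac{1+a_{j+2}f_{j+2}+a_{j+2}a_jf_{j+2}f_j}{1+a_jf_j+a_ja_{j+1}f_jf_{j+1}}\quad(j\in\mathbb Z/3\mathbb Z),$$ $$\frac{T_1(f_2)}{f_1}=\frac{1+a_1f_1+a_1^2a_2f_2+a_1a_2f_1f_2}{a_1a_2+a_1f_2+a_1^2a_2f_1+f_1f_2},\qquad \frac{T_1^{-1}(f_1)\,q}{f_2}=\frac{x^2q^2+a_1a_2f_1f_2}{x^2a_1a_2+f_1f_2},$$ $$\frac{T_2(f_1)}{f_2}=\frac{a_1a_2^2+f_1+a_1a_2f_2+a_2f_1f_2}{a_2+a_1a_2f_1+f_2+a_1a_2^2f_1f_2},\qquad \frac{T_2^{-1}(f_2)}{f_1q}=\frac{a_1a_2x^2+f_1f_2}{x^2q^2+a_1a_2f_1f_2}.$$ **Theorem.** Let $v\in\mathbb C\setminus\Lambda$ (an arbitrary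 parameter, which does not occur in the equation). For $m\in\mathbb C$, $n\in\mathbb Z_{\ge0}$ and $x=e^{\pi iu}$, put $$(x,a_1,a_2;f_1,f_2)=\Bigl(x,-q^m,q^{-n};\ \frac{\xi_{m,n,1}}{\xi_{m,n,0}}\frac{\xi_{m,n-1,0}}{\xi_{m,n-1,1}},\ -\frac{\xi_{m,n-1,1}}{\xi_{m,n-1,0}}\frac{\xi_{m-1,n-1,0}}{\xi_{m-1,n-1,1}}\Bigr).$$ Call $(u,m,n)$ regular if $u+v-m\tau\notin\Lambda$ and the six determinants in these formulas are non-zero at $u$. For all $m$ and $n$, $(u,m,n)$ is regular for all $u$ outside a closed discrete subset of $\mathbb C$. These functions solve the $(A_2+A_1)^{(1)}$ $q$-Painlevé equation, where $T$, $T_1$, $T_2$ act by $u\mapsto u+\tau$, $m\mapsto m+1$, $n\mapsto n-1$ respectively: at every regular point whose image under the shift concerned is also regular (with $n\geq1$ for $T_2$), all the equations for this shift hold, with non-zero denominators; the only exception is the equation for $T_1(f_2)$ when $q^{2m}=1$ (that is, $a_1^2=1$), where it reads $0/0$ and is not asserted. Likewise for the equations for $T_1^{-1}$ and $T_2^{-1}$.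 -/

import Mathlib

namespace QPainleve

/-- The lattice of all `a τ + b` with integers `a`, `b`. -/
def lattice (τ : ℂ) : Set ℂ := {z | ∃ a b : ℤ, z = a * τ + b}

/-- `q ^ s = exp (π i τ s)`, where `q = exp (π i τ)`. -/
noncomputable def qpow (τ s : ℂ) : ℂ := Complex.exp (Real.pi * Complex.I * τ * s)

/-- The Jacobi theta function, a sum over the half-integers `ν = n + 1/2`. -/
noncomputable def theta (τ z : ℂ) : ℂ :=
  ∑' n : ℤ, Complex.exp (2 * Real.pi * Complex.I * ((n : ℂ) + 1 / 2) * (z + 1 / 2)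
    + Real.pi * Complex.I * ((n : ℂ) + 1 / 2) ^ 2 * τ)

/-- The one-parameter extension `μ(u, v; α | τ)` of the `μ`-function of Zwegers. The factor with
index `j : ℕ` of the infinite product is the factor number `j + 1`. -/
noncomputable def mu (τ u v α : ℂ) : ℂ :=
  Complex.exp (Real.pi * Complex.I * α * (u - v)) / theta τ v *
    ∑' n : ℤ, (-1 : ℂ) ^ n * Complex.exp (2 * Real.pi * Complex.I * ((n : ℂ) + 1 / 2) * v)
      * Complex.exp (Real.pi * Complex.I * n * (n + 1) * τ)
      * ∏' j : ℕ,
          (1 - Complex.exp (2 * Real.pi * Complex.I * u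
            + 2 * Real.pi * Complex.I * ((n : ℂ) + ((j : ℂ) + 1)) * τ))
          / (1 - Complex.exp (2 * Real.pi * Complex.I * u
            + 2 * Real.pi * Complex.I * ((n : ℂ) - α + ((j : ℂ) + 1)) * τ))

/-- `ξ_{m,n,k} = det [μ(u + v + k τ, v; m - j - j')]`, of size `n + 1` for an integer `n ≥ -1`;
for `n = -1` it is the empty determinant `1`. -/
noncomputable def xi (τ v u m : ℂ) (n : ℤ) (k : ℂ) : ℂ :=
  Matrix.det (Matrix.of fun i j : Fin (n + 1).toNat =>
    mu τ (u + v + k * τ) v (m - ((i : ℕ) : ℂ) - ((j : ℕ) : ℂ)))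

/-- The variables `(x, a₁, a₂; f₁, f₂)` of the `q`-Painlevé equation. -/
structure Vars where
  x : ℂ
  a₁ : ℂ
  a₂ : ℂ
  f₁ : ℂ
  f₂ : ℂ

/-- `a₀, a₁, a₂` with `a₀ a₁ a₂ = q`, indexed by residues mod 3. -/
noncomputable def Vars.a (q : ℂ) (P : Vars) : Fin 3 → ℂ := ![q / (P.a₁ * P.a₂), P.a₁, P.a₂]

/-- `f₀, f₁, f₂` with `f₀ f₁ f₂ = x² q`, indexed by residues mod 3. -/
noncomputable def Vars.f (q : ℂ) (P : Vars) : Fin 3 → ℂ :=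
  ![P.x ^ 2 * q / (P.f₁ * P.f₂), P.f₁, P.f₂]

/-- `z` equals the quotient `N / D`, which is well defined. -/
def IsQuotient (z N D : ℂ) : Prop := D ≠ 0 ∧ z = N / D

/-- The equations for the shift `T`, where `Q` stands for `T(P)`. -/
structure EqT (q : ℂ) (P Q : Vars) : Prop where
  x : Q.x = P.x * q
  a₁ : Q.a₁ = P.a₁
  a₂ : Q.a₂ = P.a₂
  f : ∀ j : Fin 3, IsQuotient (Q.f q j)
    (P.a q j * P.a q (j + 1) * P.f q (j + 1) *
      (1 + P.a q (j + 2) * P.f q (j + 2)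
        + P.a q (j + 2) * P.a q j * P.f q (j + 2) * P.f q j))
    (1 + P.a q j * P.f q j + P.a q j * P.a q (j + 1) * P.f q j * P.f q (j + 1))

/-- The action of `T₁` on `(x, a₁, a₂)`, where `Q` stands for `T₁(P)`. -/
structure ShiftT₁ (q : ℂ) (P Q : Vars) : Prop where
  x : Q.x = P.x
  a₁ : Q.a₁ = P.a₁ * q
  a₂ : Q.a₂ = P.a₂

/-- The equation for `T₁(f₂) / f₁`, where `Q` stands for `T₁(P)`. -/
def EqT₁ (P Q : Vars) : Prop :=
  IsQuotient (Q.f₂ / P.f₁)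
    (1 + P.a₁ * P.f₁ + P.a₁ ^ 2 * P.a₂ * P.f₂ + P.a₁ * P.a₂ * P.f₁ * P.f₂)
    (P.a₁ * P.a₂ + P.a₁ * P.f₂ + P.a₁ ^ 2 * P.a₂ * P.f₁ + P.f₁ * P.f₂)

/-- The equation for `T₁⁻¹(f₁) q / f₂` at `P`, where `R` stands for `T₁⁻¹(P)`. -/
def EqT₁Inv (q : ℂ) (P R : Vars) : Prop :=
  IsQuotient (R.f₁ * q / P.f₂)
    (P.x ^ 2 * q ^ 2 + P.a₁ * P.a₂ * P.f₁ * P.f₂)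
    (P.x ^ 2 * P.a₁ * P.a₂ + P.f₁ * P.f₂)

/-- The action of `T₂` on `(x, a₁, a₂)`, where `Q` stands for `T₂(P)`. -/
structure ShiftT₂ (q : ℂ) (P Q : Vars) : Prop where
  x : Q.x = P.x
  a₁ : Q.a₁ = P.a₁
  a₂ : Q.a₂ = P.a₂ * q

/-- The equation for `T₂(f₁) / f₂`, where `Q` stands for `T₂(P)`. -/
def EqT₂ (P Q : Vars) : Prop :=
  IsQuotient (Q.f₁ / P.f₂)
    (P.a₁ * P.a₂ ^ 2 + P.f₁ + P.a₁ * P.a₂ * P.f₂ + P.a₂ * P.f₁ * P.f₂)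
    (P.a₂ + P.a₁ * P.a₂ * P.f₁ + P.f₂ + P.a₁ * P.a₂ ^ 2 * P.f₁ * P.f₂)

/-- The equation for `T₂⁻¹(f₂) / (f₁ q)` at `P`, where `R` stands for `T₂⁻¹(P)`. -/
def EqT₂Inv (q : ℂ) (P R : Vars) : Prop :=
  IsQuotient (R.f₂ / (P.f₁ * q))
    (P.a₁ * P.a₂ * P.x ^ 2 + P.f₁ * P.f₂)
    (P.x ^ 2 * q ^ 2 + P.a₁ * P.a₂ * P.f₁ * P.f₂)

/-- The values `(x, a₁, a₂; f₁, f₂)` built from the determinants `ξ`, with `x = exp (π i u)`,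
`a₁ = -q ^ m`, `a₂ = q ^ (-n)`. -/
noncomputable def sol (τ v u m : ℂ) (n : ℤ) : Vars where
  x := Complex.exp (Real.pi * Complex.I * u)
  a₁ := -qpow τ m
  a₂ := qpow τ (-n)
  f₁ := xi τ v u m n 1 / xi τ v u m n 0 * (xi τ v u m (n - 1) 0 / xi τ v u m (n - 1) 1)
  f₂ := -(xi τ v u m (n - 1) 1 / xi τ v u m (n - 1) 0
    * (xi τ v u (m - 1) (n - 1) 0 / xi τ v u (m - 1) (n - 1) 1))

/-- `u` avoids the poles of all the functions `μ(u + v + k τ, v; m - j)` with integers `k`, `j`,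
and `f₁`, `f₂` are well defined and non-zero at `u`: the numerators and denominators
do not vanish. -/
structure Regular (τ v u m : ℂ) (n : ℤ) : Prop where
  not_pole : u + v - m * τ ∉ lattice τ
  xi_ne : ∀ k : Fin 2, xi τ v u m n (k : ℕ) ≠ 0 ∧ xi τ v u m (n - 1) (k : ℕ) ≠ 0 ∧
    xi τ v u (m - 1) (n - 1) (k : ℕ) ≠ 0

end QPainleve

/-! Put p = q², Q = q^(-2m), w = e^(2πiv), X = e^(2πi(u+v)), y = e^(2πiu). Up to a factor which is
geometric in N, μ(u+v, v; m-N) is the bilateral series `qSeries` with parameter a = Q p^N. A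
geometric factor leaves a Hankel determinant only through an explicit non-zero constant, so every ξ
is such a constant times the Hankel determinant `tau` of the sequence h_u(N) of these series
(`xi_eq`). The constants are collected in `tauVars` (`sol_eq`).

Two contiguity relations of the series say how the shift E in N acts: (E - y) h_u = h_{u+τ} and (E -
1) h_u = y Q p^N h_{u-τ}, while E itself replaces m by m - 1 (`Contiguous`, `contiguous_tauSeq`).
Thus the operators E - c with c = y, 1, 0 move along the lattice of translations of (u, m). The
parameter v has disappeared from the relations.

For arbitrary constants the Hankel determinants of h, (E - a)h, (E - a)(E - b)h, … satisfy bilinear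
identities, all of them cases of the Desnanot–Jacobi identity (`hank_identity_two_infinite`,
`hank_identity_one_infinite`, `hank_identity_finite`, `hank_identity_sizes`). Constants from {0, 1,
y} turn them into bilinear relations between tau functions at neighbouring points. By these, each
numerator and denominator in the Painlevé equations becomes a product of tau functions, non-zero at
regular points; for T₁ there is an extra common factor 1 - a₁², which explains the exception.

For regularity, a power of a theta function clears the poles of `tau` and gives an entire function
of u. It is not identically zero: row operations with E - 1, E - p, E - p², … turn the Hankel matrix
into one that tends, as X p^M → 0, to a Vandermonde matrix times the theta series of w. That series
is non-zero for v outside the lattice, by the Jacobi triple product. -/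

namespace QPainleve

/-! ### The Desnanot–Jacobi identity -/

section Determinants

open Matrix

variable {R : Type*} [CommRing R]

/-- The Desnanot–Jacobi identity, in terms of determinants with replaced rows. -/
theorem det_mul_det_updateRow_updateRow {ι : Type*} [Fintype ι] [DecidableEq ι]
    (A : Matrix ι ι R) {i₀ i₁ : ι} (hi : i₀ ≠ i₁) (j₀ j₁ : ι) :
    A.det * ((A.updateRow i₀ (Pi.single j₀ 1)).updateRow i₁ (Pi.single j₁ 1)).det
      = A.adjugate j₀ i₀ * A.adjugate j₁ i₁ - A.adjugate j₀ i₁ * A.adjugate j₁ i₀ := by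
  -- Cramer's rule for rows: det A times a unit vector is a combination of the rows of A.
  -- Substituting it for the row `i₁` leaves only the terms `i₁` and `i₀`, since every other row of
  -- A would occur twice.
  have key : A.det • (Pi.single j₁ 1 : ι → R) = ∑ i, A.adjugate j₁ i • A i := by
    ext k
    have := congrFun (congrFun (adjugate_mul A) j₁) k
    rw [mul_apply] at this
    simp only [Pi.smul_apply, Finset.sum_apply, smul_eq_mul, this]
    simp [Pi.single_apply, one_apply, eq_comm]
  set B := A.updateRow i₀ (Pi.single j₀ 1) with hB
  have hexp : A.det * (B.updateRow i₁ (Pi.single j₁ 1)).det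
      = ∑ i, A.adjugate j₁ i * (B.updateRow i₁ (A i)).det := by
    rw [← det_updateRow_smul, key]
    exact (detRowAlternating.toMultilinearMap.map_update_sum Finset.univ i₁
      (fun i => A.adjugate j₁ i • A i) B).trans
      (Finset.sum_congr rfl fun i _ => det_updateRow_smul B i₁ (A.adjugate j₁ i) (A i))
  rw [hexp, Finset.sum_eq_add i₁ i₀ hi.symm]
  · have h1 : B.updateRow i₁ (A i₁) = B := by
      ext a b
      by_cases h : a = i₁
      · subst h; simp [hB, updateRow_apply, hi.symm]
      · simp [updateRow_apply, h]
    have h2 : (B.updateRow i₁ (A i₀)).det = - A.adjugate j₀ i₁ := by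
      rw [adjugate_apply]
      have : B.updateRow i₁ (A i₀)
          = (A.updateRow i₁ (Pi.single j₀ 1)).submatrix (Equiv.swap i₀ i₁) id := by
        ext a b
        simp only [hB, updateRow_apply, submatrix_apply, id]
        by_cases ha : a = i₁
        · subst ha; simp [hi]
        · by_cases hb : a = i₀
          · subst hb; simp [ha]
          · simp [ha, hb, Equiv.swap_apply_of_ne_of_ne]
      rw [this, det_permute, Equiv.Perm.sign_swap hi]
      simp
    rw [h1, h2, adjugate_apply A j₀ i₀, ← hB]
    ring
  · intro i _ ⟨h1, h0⟩
    have : (B.updateRow i₁ (A i)).det = 0 := by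
      apply det_zero_of_row_eq (i := i) (j := i₁) h1
      ext b
      simp [hB, updateRow_apply, h1, h0]
    rw [this, mul_zero]
  · simp
  · simp

theorem det_updateRow_single {n : ℕ} (A : Matrix (Fin (n + 1)) (Fin (n + 1)) R)
    (i j : Fin (n + 1)) :
    (A.updateRow i (Pi.single j 1)).det
      = (-1) ^ ((i : ℕ) + j) * (A.submatrix i.succAbove j.succAbove).det := by
  rw [← adjugate_apply, adjugate_fin_succ_eq_det_submatrix]

/-- The Desnanot–Jacobi identity for the minors which omit row `0` or row `a + 1`, and
column `0` or column `b + 1`. -/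
theorem det_mul_det_minor {n : ℕ} (A : Matrix (Fin (n + 2)) (Fin (n + 2)) R) (a b : Fin (n + 1)) :
    A.det * (A.submatrix (fun i => a.succ.succAbove (Fin.succ i))
        (fun j => b.succ.succAbove (Fin.succ j))).det
      = (A.submatrix Fin.succ Fin.succ).det
          * (A.submatrix a.succ.succAbove b.succ.succAbove).det
        - (A.submatrix a.succ.succAbove Fin.succ).det
          * (A.submatrix Fin.succ b.succ.succAbove).det := by
  have h := det_mul_det_updateRow_updateRow A (i₀ := 0) (i₁ := a.succ)
    (Fin.succ_ne_zero a).symm 0 b.succ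
  -- Deleting a row and a column other than the zeroth keeps the inserted unit vector in place, so
  -- the doubly modified determinant can be expanded twice.
  have h2 : ((A.updateRow 0 (Pi.single 0 1)).submatrix a.succ.succAbove b.succ.succAbove)
      = (A.submatrix a.succ.succAbove b.succ.succAbove).updateRow 0 (Pi.single 0 1) := by
    ext i j
    have hi : a.succ.succAbove i = 0 ↔ i = 0 := by
      rw [← Fin.succAbove_right_inj (p := a.succ) (i := i), Fin.succAbove_ne_zero_zero]
      exact Fin.succ_ne_zero a
    have hj : b.succ.succAbove j = 0 ↔ j = 0 := by
      rw [← Fin.succAbove_right_inj (p := b.succ) (i := j), Fin.succAbove_ne_zero_zero]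
      exact Fin.succ_ne_zero b
    simp [updateRow_apply, hi, hj, Pi.single_apply]
  rw [det_updateRow_single, h2, det_updateRow_single] at h
  simp only [adjugate_fin_succ_eq_det_submatrix, Fin.succAbove_zero, submatrix_submatrix,
    Function.comp_def] at h
  have hs : ((-1 : R) ^ ((a.succ : ℕ) + (b.succ : ℕ))) * (-1) ^ ((a.succ : ℕ) + (b.succ : ℕ)) = 1 := by
    rw [← mul_pow]; simp
  have h3 := congrArg (fun z => (-1 : R) ^ ((a.succ : ℕ) + (b.succ : ℕ)) * z) h
  simp only [Fin.val_zero, add_zero, zero_add, pow_zero, one_mul, pow_add] at h3 hs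
  linear_combination h3 + (A.det * (A.submatrix (fun i => a.succ.succAbove (Fin.succ i))
        (fun j => b.succ.succAbove (Fin.succ j))).det * -1
      + (A.submatrix Fin.succ Fin.succ).det
          * (A.submatrix a.succ.succAbove b.succ.succAbove).det
        - (A.submatrix a.succ.succAbove Fin.succ).det
          * (A.submatrix Fin.succ b.succ.succAbove).det) * hs

end Determinants

/-! ### Bilinear identities for Hankel determinants -/

section Hankel

open Matrix

variable {R : Type*} [CommRing R]

/-- The sequence `(E - a) h`, where `E` is the shift. -/
def chr (a : R) (h : ℕ → R) : ℕ → R := fun N => h (N + 1) - a * h N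

/-- The determinant of the first `n` columns of a family of `n` sequences. -/
def rowsDet {n : ℕ} (F : Fin n → ℕ → R) : R := det (of fun i j : Fin n => F i j)

/-- The Hankel determinant of size `n`. -/
def hank (n : ℕ) (h : ℕ → R) : R := det (of fun i j : Fin n => h (i + j))

theorem hank_zero (h : ℕ → R) : hank 0 h = 1 := by simp [hank]

theorem chr_comm (a b : R) (h : ℕ → R) : chr a (chr b h) = chr b (chr a h) := by
  funext N; simp only [chr]; ring

theorem chr_zero (h : ℕ → R) : chr 0 h = fun N => h (N + 1) := by
  funext N; simp [chr]

theorem rowsDet_shift (n : ℕ) (h : ℕ → R) :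
    rowsDet (fun (i : Fin n) N => h (i + N)) = hank n h := rfl

/-- Subtracting `a` times the preceding column from each column applies E - a to the rows of all
columns but the first. -/
theorem rowsDet_eq_cols {n : ℕ} (a : R) (F : Fin (n + 1) → ℕ → R) :
    rowsDet F = det (of fun i j => Fin.cases (F i 0) (fun k : Fin n => chr a (F i) k) j) := by
  refine det_eq_of_forall_col_eq_smul_add_pred (fun _ => a) (fun i => by simp) fun i j => ?_
  simp [chr]

/-- The same operation on rows: in a Hankel matrix the row index also acts as the shift E. -/
theorem rowsDet_eq_rows {n : ℕ} (c : R) (h : ℕ → R) :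
    rowsDet (fun i : Fin (n + 1) => Fin.cases h (fun k N => chr c h (k + N)) i)
      = hank (n + 1) h := by
  symm
  refine det_eq_of_forall_row_eq_smul_add_pred (fun _ => c) (fun i => by simp) fun i j => ?_
  simp only [of_apply, Fin.cases_succ, chr, Fin.val_succ, Fin.val_castSucc]
  rw [show (i : ℕ) + 1 + j = i + j + 1 by ring]
  ring

/-- Desnanot–Jacobi for the matrix of `rowsDet_eq_cols`, with the first and last rows and columns
removed: without the first column it involves only the sequences (E - a)F, without the last one it
is the same kind of determinant of F, one size smaller. -/
theorem rowsDet_mul_rowsDet_chr {n : ℕ} (a : R) (F : Fin (n + 2) → ℕ → R) :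
    rowsDet F * rowsDet (fun i : Fin n => chr a (F i.castSucc.succ))
      = rowsDet (fun i : Fin (n + 1) => chr a (F i.succ)) *
          rowsDet (fun i : Fin (n + 1) => F i.castSucc)
        - rowsDet (fun i : Fin (n + 1) => chr a (F i.castSucc)) *
          rowsDet (fun i : Fin (n + 1) => F i.succ) := by
  have h := det_mul_det_minor
    (of fun i j => Fin.cases (motive := fun _ => R) (F i 0) (fun k : Fin (n + 1) => chr a (F i) k) j)
    (Fin.last n) (Fin.last n)
  rw [← rowsDet_eq_cols a F] at h
  rw [rowsDet_eq_cols a (fun i : Fin (n + 1) => F i.castSucc),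
    rowsDet_eq_cols a (fun i : Fin (n + 1) => F i.succ)]
  have e1 : ∀ f : Fin (n + 1) → ℕ → R,
      (of fun i j => Fin.cases (f i 0) (fun k : Fin n => chr a (f i) k) j)
      = of fun i (j : Fin (n + 1)) => (Fin.cases (f i 0) (fun k : Fin (n + 1) => chr a (f i) k)
        j.castSucc : R) := by
    intro f
    ext i j
    refine Fin.cases ?_ (fun k => ?_) j <;> simp
  rw [e1, e1]
  simp only [Fin.succ_last, Fin.succAbove_last] at h
  exact h

/-- The two leading columns come from (E - a)F = (E - b)F + (b - a)F: up to adding the second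
column, the first one is b - a times the values F(0). -/
theorem det_cols_pair {n : ℕ} (a b : R) (F : Fin (n + 2) → ℕ → R) :
    det (of fun i j => Fin.cases (chr a (F i) 0) (Fin.cases (chr b (F i) 0)
      (fun k : Fin n => chr a (chr b (F i)) k)) j) = (b - a) * rowsDet F := by
  set B : Matrix (Fin (n + 2)) (Fin (n + 2)) R := of fun i j => Fin.cases (F i 0)
    (Fin.cases (chr b (F i) 0) (fun k : Fin n => chr a (chr b (F i)) k)) j with hB
  have h1 : rowsDet F = B.det := by
    rw [rowsDet_eq_cols b]
    refine det_eq_of_forall_col_eq_smul_add_pred (Fin.cases 0 fun _ => a) (fun i => by simp [hB])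
      fun i j => ?_
    refine Fin.cases ?_ (fun k => ?_) j
    · rw [Fin.cases_zero, zero_mul, add_zero]
      rfl
    · simp [hB, chr]
  have h2 : (B.updateCol 0 ((b - a) • fun i => B i 0)).updateCol 0
      (fun k => (B.updateCol 0 ((b - a) • fun i => B i 0)) k 0
        + (1 : R) • (B.updateCol 0 ((b - a) • fun i => B i 0)) k 1)
      = of fun i j => Fin.cases (chr a (F i) 0) (Fin.cases (chr b (F i) 0)
      (fun k : Fin n => chr a (chr b (F i)) k)) j := by
    ext i j
    refine Fin.cases ?_ (fun k => ?_) j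
    · have : B i 1 = chr b (F i) 0 := rfl
      simp [this]
      simp [hB, chr]
      ring
    · simp [hB]
  rw [← h2, det_updateCol_add_smul_self _ (by simp), det_updateCol_smul, h1]
  congr 2
  ext i j
  by_cases h : j = 0
  · subst h; simp
  · simp [h]

/-- Here the two columns removed are the leading ones in `det_cols_pair`. Without the column of `a`
the rest is a determinant of (E - b)F, without that of `b` one of (E - a)F, without both one of (E -
a)(E - b)F. -/
theorem rowsDet_mul_rowsDet_chr_chr {n : ℕ} (a b : R) (F : Fin (n + 2) → ℕ → R)
    (r : Fin (n + 1)) :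
    (b - a) * rowsDet F * rowsDet (fun i : Fin n => chr a (chr b (F (r.succ.succAbove i.succ))))
      = rowsDet (fun i : Fin (n + 1) => chr b (F i.succ)) *
          rowsDet (fun i : Fin (n + 1) => chr a (F (r.succ.succAbove i)))
        - rowsDet (fun i : Fin (n + 1) => chr b (F (r.succ.succAbove i))) *
          rowsDet (fun i : Fin (n + 1) => chr a (F i.succ)) := by
  have h := det_mul_det_minor (of fun i j => Fin.cases (motive := fun _ => R) (chr a (F i) 0)
      (Fin.cases (motive := fun _ => R) (chr b (F i) 0)
      (fun k : Fin n => chr a (chr b (F i)) k)) j) r 0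
  rw [det_cols_pair] at h
  have e1 : ∀ f : Fin (n + 1) → Fin (n + 2), rowsDet (fun i : Fin (n + 1) => chr b (F (f i)))
      = ((of fun i j => (Fin.cases (chr a (F i) 0) (Fin.cases (chr b (F i) 0)
      (fun k : Fin n => chr a (chr b (F i)) k)) j : R)).submatrix f Fin.succ).det := by
    intro f
    rw [rowsDet_eq_cols a]
    rfl
  have e2 : ∀ f : Fin (n + 1) → Fin (n + 2), rowsDet (fun i : Fin (n + 1) => chr a (F (f i)))
      = ((of fun i j => (Fin.cases (chr a (F i) 0) (Fin.cases (chr b (F i) 0)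
      (fun k : Fin n => chr a (chr b (F i)) k)) j : R)).submatrix f
        (Fin.succ 0).succAbove).det := by
    intro f
    rw [rowsDet_eq_cols b]
    congr 1
    ext i j
    refine Fin.cases ?_ (fun k => ?_) j
    · rfl
    · have : (Fin.succ 0 : Fin (n + 2)).succAbove k.succ = k.succ.succ := by
        rw [Fin.succ_succAbove_succ, Fin.succAbove_zero]
      simp only [of_apply, submatrix_apply, this, Fin.cases_succ, chr_comm a b]
  rw [e1, e1, e2, e2]
  exact h

/-- In this identity and the next two, Desnanot–Jacobi carries two constants for columns and two for
rows. An "infinite" constant is one whose operator E - c is replaced by the identity; here one on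
each side is infinite. -/
theorem hank_identity_two_infinite (n : ℕ) (a c : R) (h : ℕ → R) :
    hank (n + 2) h * hank n (chr a (chr c h))
      = hank (n + 1) (chr a (chr c h)) * hank (n + 1) h
        - hank (n + 1) (chr a h) * hank (n + 1) (chr c h) := by
  have key := rowsDet_mul_rowsDet_chr a
    (fun i : Fin (n + 2) => Fin.cases h (fun k N => chr c h (k + N)) i)
  rw [rowsDet_eq_rows] at key
  have e1 : rowsDet (fun i : Fin (n + 1) => (Fin.cases h (fun (k : Fin (n + 1)) N =>
      chr c h (k + N)) i.castSucc : ℕ → R)) = hank (n + 1) h := by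
    rw [← rowsDet_eq_rows c]
    congr 1
    ext i
    refine Fin.cases ?_ (fun k => ?_) i <;> simp
  have e2 : rowsDet (fun i : Fin (n + 1) => chr a (Fin.cases h (fun (k : Fin (n + 1)) N =>
      chr c h (k + N)) i.castSucc : ℕ → R)) = hank (n + 1) (chr a h) := by
    rw [← rowsDet_eq_rows c]
    congr 1
    ext i N
    refine Fin.cases ?_ (fun k => ?_) i
    · simp
    · simp [chr_comm c a]
      rfl
  rw [e1, e2] at key
  exact key

theorem hank_identity_one_infinite (n : ℕ) (a b c : R) (h : ℕ → R) :
    (b - a) * hank (n + 2) h * hank n (chr a (chr b (chr c h)))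
      = hank (n + 1) (chr b (chr c h)) * hank (n + 1) (chr a h)
        - hank (n + 1) (chr b h) * hank (n + 1) (chr a (chr c h)) := by
  have key := rowsDet_mul_rowsDet_chr_chr a b
    (fun i : Fin (n + 2) => Fin.cases h (fun k N => chr c h (k + N)) i) (Fin.last n)
  rw [rowsDet_eq_rows] at key
  have e2 : ∀ a : R, rowsDet (fun i : Fin (n + 1) => chr a (Fin.cases h (fun (k : Fin (n + 1)) N =>
      chr c h (k + N)) i.castSucc : ℕ → R)) = hank (n + 1) (chr a h) := by
    intro a
    rw [← rowsDet_eq_rows c]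
    congr 1
    ext i N
    refine Fin.cases ?_ (fun k => ?_) i
    · simp
    · simp [chr_comm c a]
      rfl
  simp only [Fin.succ_last, Fin.succAbove_last] at key
  rw [e2, e2] at key
  exact key

theorem hank_identity_finite (n : ℕ) (a b c d : R) (h : ℕ → R) :
    (b - a) * (d - c) * hank (n + 2) h * hank n (chr a (chr b (chr c (chr d h))))
      = hank (n + 1) (chr b (chr d h)) * hank (n + 1) (chr a (chr c h))
        - hank (n + 1) (chr b (chr c h)) * hank (n + 1) (chr a (chr d h)) := by
  have key := rowsDet_mul_rowsDet_chr_chr a b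
    (fun i : Fin (n + 2) => Fin.cases (chr c h) (Fin.cases (chr d h)
      (fun k N => chr c (chr d h) (k + N))) i) 0
  have e0 : rowsDet (fun i : Fin (n + 2) => Fin.cases (chr c h) (Fin.cases (chr d h)
      (fun k N => chr c (chr d h) (k + N))) i) = (d - c) * hank (n + 2) h := by
    -- A Hankel matrix is symmetric, so the pair of leading rows is treated by transposing
    -- `det_cols_pair`.
    have := det_cols_pair c d (fun (i : Fin (n + 2)) N => h (i + N))
    rw [rowsDet_shift] at this
    rw [← this, rowsDet, ← det_transpose]
    congr 1
    ext i j
    refine Fin.cases ?_ (fun k => Fin.cases ?_ (fun l => ?_) k) j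
    · simp [chr, add_comm]
    · change chr d h i = chr d (fun N => h (i + N)) 0
      simp [chr]
    · simp [chr, add_comm, add_left_comm, add_assoc]
  have e1 : ∀ a : R, rowsDet (fun i : Fin (n + 1) => chr a ((Fin.cases (chr c h)
      (Fin.cases (chr d h) (fun (k : Fin n) N => chr c (chr d h) (k + N))) i.succ : ℕ → R)))
      = hank (n + 1) (chr a (chr d h)) := by
    intro a
    rw [← rowsDet_eq_rows c]
    congr 1
    ext i N
    refine Fin.cases ?_ (fun k => ?_) i
    · rfl
    · simp [chr_comm c a]
      rfl
  have e2 : ∀ a : R, rowsDet (fun i : Fin (n + 1) => chr a ((Fin.cases (chr c h)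
      (Fin.cases (chr d h) (fun (k : Fin n) N => chr c (chr d h) (k + N)))
        ((Fin.succ 0 : Fin (n + 2)).succAbove i) : ℕ → R)))
      = hank (n + 1) (chr a (chr c h)) := by
    intro a
    rw [← rowsDet_eq_rows d]
    congr 1
    ext i N
    refine Fin.cases ?_ (fun k => ?_) i
    · rfl
    · rw [Fin.succ_succAbove_succ, Fin.succAbove_zero]
      simp [chr_comm c d, chr_comm d a]
      rfl
  rw [e0, e1, e1, e2, e2] at key
  rw [← key]
  have e3 : (fun i : Fin n => chr a (chr b ((Fin.cases (chr c h)
      (Fin.cases (chr d h) (fun (k : Fin n) N => chr c (chr d h) (k + N)))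
        ((Fin.succ 0 : Fin (n + 2)).succAbove i.succ) : ℕ → R))))
      = fun (i : Fin n) N => chr a (chr b (chr c (chr d h))) (i + N) := by
    ext i N
    rw [Fin.succ_succAbove_succ, Fin.succAbove_zero]
    rfl
  rw [e3, rowsDet_shift]
  ring

theorem rowsDet_cons_single {n : ℕ} (F : Fin (n + 1) → ℕ → R)
    (h0 : ∀ j : Fin (n + 1), F 0 j = if j = Fin.last n then 1 else 0) :
    rowsDet F = (-1) ^ n * rowsDet (fun i : Fin n => F i.succ) := by
  rw [rowsDet, det_succ_row_zero, Finset.sum_eq_single (Fin.last n)]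
  · have h1 : F 0 ((Fin.last n : Fin (n + 1)) : ℕ) = 1 := by rw [h0]; simp
    rw [of_apply, h1, Fin.succAbove_last, Fin.val_last, mul_one]
    rfl
  · intro j _ hj
    simp [h0, hj]
  · simp

/-- The Hankel rows are bordered by a unit row that picks out the last column. Expanding along it
lowers the size by one, which brings determinants of different sizes into one identity. -/
theorem hank_identity_sizes (n : ℕ) (a b : R) (h : ℕ → R) :
    (a - b) * hank (n + 1) h * hank n (chr a (chr b h))
      = hank (n + 1) (chr b h) * hank n (chr a h)
        - hank n (chr b h) * hank (n + 1) (chr a h) := by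
  have key := rowsDet_mul_rowsDet_chr_chr a b
    (fun i : Fin (n + 2) => Fin.cases (fun N => if N = n + 1 then 1 else 0)
      (fun k N => h (k + N)) i) (Fin.last n)
  simp only [Fin.succ_last, Fin.succAbove_last] at key
  rw [rowsDet_cons_single (n := n + 1)] at key
  swap
  · intro j; simp [Fin.ext_iff]
  have e2 : ∀ a : R, rowsDet (fun i : Fin (n + 1) => chr a ((Fin.cases
      (fun N => if N = n + 1 then 1 else 0)
      (fun (k : Fin (n + 1)) N => h (k + N)) i.castSucc : ℕ → R)))
      = (-1) ^ n * hank n (chr a h) := by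
    intro a
    rw [rowsDet_cons_single]
    · rfl
    · intro j
      have := j.2
      simp [chr, Fin.ext_iff]
      -- On the columns 0, …, n, the operator E - a sends the unit sequence at n + 1 to the one at
      -- n: the term with factor `a` would need the column n + 1.
      intro; omega
  rw [e2, e2] at key
  have e3 : ∀ a : R, rowsDet (fun i : Fin (n + 1) => chr a ((Fin.cases
      (fun N => if N = n + 1 then 1 else 0)
      (fun (k : Fin (n + 1)) N => h (k + N)) i.succ : ℕ → R))) = hank (n + 1) (chr a h) :=
    fun a => rfl
  have e4 : rowsDet (fun i : Fin n => chr a (chr b ((Fin.cases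
      (fun N => if N = n + 1 then 1 else 0)
      (fun (k : Fin (n + 1)) N => h (k + N)) i.succ.castSucc : ℕ → R))))
      = hank n (chr a (chr b h)) := rfl
  have e5 : rowsDet (fun i : Fin (n + 1) => ((Fin.cases
      (fun N => if N = n + 1 then 1 else 0)
      (fun (k : Fin (n + 1)) N => h (k + N)) i.succ : ℕ → R))) = hank (n + 1) h := rfl
  rw [e3, e3, e4, e5] at key
  have hs : ((-1 : R) ^ n) * (-1) ^ n = 1 := by rw [← mul_pow]; simp
  have := congrArg (fun z => (-1 : R) ^ n * z) key
  simp only [pow_succ] at this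
  linear_combination this + ((a - b) * -1 * hank (n + 1) h * hank n (chr a (chr b h))
    + hank (n + 1) (chr b h) * hank n (chr a h) - hank n (chr b h) * hank (n + 1) (chr a h)) * hs

end Hankel

/-! ### Bilinear relations for contiguous sequences -/

section Tau

variable {K : Type*} [Field K]

/-- The shifted sequence. -/
def sh (h : ℕ → K) : ℕ → K := fun N => h (N + 1)

theorem chr_zero_eq_sh (h : ℕ → K) : chr 0 h = sh h := chr_zero h

theorem chr_sh (a : K) (h : ℕ → K) : chr a (sh h) = sh (chr a h) := rfl

/-- The factor `r ^ (n (n - 1))`. -/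
def gauge (r : K) (n : ℕ) : K := ∏ i ∈ Finset.range n, r ^ (2 * i)

theorem gauge_succ (r : K) (n : ℕ) : gauge r (n + 1) = gauge r n * r ^ (2 * n) :=
  Finset.prod_range_succ _ _

theorem gauge_ne_zero {r : K} (hr : r ≠ 0) (n : ℕ) : gauge r n ≠ 0 :=
  Finset.prod_ne_zero_iff.2 fun _ _ => pow_ne_zero _ hr

/-- The factor r^(i+j) splits into a row factor r^i and a column factor r^j, each contributing r^(0
+ 1 + … + (n-1)). -/
theorem hank_geom (n : ℕ) (c r : K) (f : ℕ → K) :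
    hank n (fun N => c * r ^ N * f N) = c ^ n * gauge r n * hank n f := by
  have h1 : (Matrix.of fun i j : Fin n => c * r ^ ((i : ℕ) + j) * f (i + j))
      = Matrix.of fun i j : Fin n => (c * r ^ (i : ℕ)) *
        (Matrix.of fun i j : Fin n => r ^ (j : ℕ) * f (i + j)) i j := by
    ext i j; simp [pow_add]; ring
  have h2 : (Matrix.of fun i j : Fin n => r ^ (j : ℕ) * f (i + j))
      = Matrix.of fun i j : Fin n => (fun j : Fin n => r ^ (j : ℕ)) j *
        (Matrix.of fun i j : Fin n => f (i + j)) i j := by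
    ext i j; simp
  rw [hank, h1, Matrix.det_mul_column, h2, Matrix.det_mul_row, hank, Finset.prod_mul_distrib]
  simp only [Finset.prod_const, Finset.card_univ, Fintype.card_fin]
  rw [Fin.prod_univ_eq_prod_range (fun i => r ^ i) n, gauge]
  have : ∏ i ∈ Finset.range n, r ^ (2 * i)
      = (∏ i ∈ Finset.range n, r ^ i) * ∏ i ∈ Finset.range n, r ^ i := by
    rw [← Finset.prod_mul_distrib]
    exact Finset.prod_congr rfl fun i _ => by ring
  rw [this]; ring

/-- The contiguity relations between the solutions of index `k - 1`, `k` and `k + 1`. -/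
structure Contiguous (p Q y : K) (hm h hp : ℕ → K) : Prop where
  down : chr 1 h = fun N => y * Q * p ^ N * hm N
  up : chr y h = hp
  both : chr 1 (chr y h) = fun N => y * Q * p * p ^ N * h N

theorem sh_geom (c r : K) (f : ℕ → K) :
    sh (fun N => c * r ^ N * f N) = fun N => c * r * r ^ N * sh f N := by
  funext N; simp only [sh, pow_succ]; ring

/-- The Hankel determinant of size `n - 1` of the shifted sequence, and `0` for `n = 0`. -/
def hankPred : ℕ → (ℕ → K) → K
  | 0, _ => 0
  | n + 1, h => hank n (sh h)

variable {p Q y : K} {hm h hp : ℕ → K}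

namespace Contiguous

theorem shift (hc : Contiguous p Q y hm h hp) : Contiguous p (Q * p) y (sh hm) (sh h) (sh hp) where
  down := by
    rw [chr_sh, hc.down, sh_geom]; funext N; ring
  up := by rw [chr_sh, hc.up]
  both := by
    rw [chr_sh, chr_sh, hc.both, sh_geom]; funext N; ring

theorem hank_down (hc : Contiguous p Q y hm h hp) (n : ℕ) :
    hank n (chr 1 h) = (y * Q) ^ n * gauge p n * hank n hm := by
  rw [hc.down, hank_geom]

theorem hank_both (hc : Contiguous p Q y hm h hp) (n : ℕ) :
    hank n (chr 1 (chr y h)) = (y * Q * p) ^ n * gauge p n * hank n h := by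
  rw [hc.both, hank_geom]

theorem up_size (hc : Contiguous p Q y hm h hp) (n : ℕ) :
    hank n (sh h) * hank (n + 1) hp + y * hank n (sh hp) * hank (n + 1) h
      = hank n hp * hank (n + 1) (sh h) := by
  have := hank_identity_sizes n 0 y h
  rw [hc.up, chr_zero_eq_sh, chr_zero_eq_sh] at this
  linear_combination -this

theorem down_size (hc : Contiguous p Q y hm h hp) (h0 : p ≠ 0) (hy : y ≠ 0) (hQ : Q ≠ 0) (n : ℕ) :
    y * Q * p ^ (2 * n) * hank n (sh h) * hank (n + 1) hm + p ^ n * hank n (sh hm) * hank (n + 1) h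
      = hank n hm * hank (n + 1) (sh h) := by
  have := hank_identity_sizes n 0 1 h
  rw [chr_comm 0 1, chr_zero_eq_sh, hc.hank_down, hc.shift.hank_down, hc.hank_down,
    gauge_succ] at this
  have hg := gauge_ne_zero h0 n
  apply mul_left_cancel₀ (mul_ne_zero (pow_ne_zero n (mul_ne_zero hy hQ)) hg)
  linear_combination -this

theorem both_size (hc : Contiguous p Q y hm h hp) (h0 : p ≠ 0) (hy : y ≠ 0) (hQ : Q ≠ 0) (n : ℕ) :
    (1 - y) * p ^ n * hank (n + 1) h * hank n h + y * Q * p ^ (2 * n) * hank (n + 1) hm * hank n hp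
      = hank n hm * hank (n + 1) hp := by
  have := hank_identity_sizes n 1 y h
  rw [hc.hank_both, hc.hank_down, hc.hank_down, hc.up, gauge_succ] at this
  have hg := gauge_ne_zero h0 n
  apply mul_left_cancel₀ (mul_ne_zero (pow_ne_zero n (mul_ne_zero hy hQ)) hg)
  linear_combination this

/-- The value 0 of `hankPred` at n = 0 is what makes this and the following relations valid for the
empty determinant. -/
theorem up_toda (hc : Contiguous p Q y hm h hp) (n : ℕ) :
    hank (n + 1) h * hankPred n hp = hank n h * hank n (sh hp) - hank n hp * hank n (sh h) := by
  cases n with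
  | zero => simp [hankPred, hank_zero]
  | succ n =>
    have := hank_identity_two_infinite n 0 y h
    rw [hc.up, chr_zero_eq_sh, chr_zero_eq_sh] at this
    simp only [hankPred]
    linear_combination this

theorem down_toda (hc : Contiguous p Q y hm h hp) (h0 : p ≠ 0) (hy : y ≠ 0) (hQ : Q ≠ 0) (n : ℕ) :
    p ^ n * hank (n + 2) h * hank n (sh hm)
      = y * Q * p ^ (2 * n) * (p ^ (n + 1) * hank (n + 1) h * hank (n + 1) (sh hm)
        - hank (n + 1) hm * hank (n + 1) (sh h)) := by
  have := hank_identity_two_infinite n 1 0 h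
  rw [chr_zero_eq_sh, hc.shift.hank_down, hc.shift.hank_down, hc.hank_down, gauge_succ] at this
  have hg := gauge_ne_zero h0 n
  apply mul_left_cancel₀ (mul_ne_zero (pow_ne_zero n (mul_ne_zero hy hQ)) hg)
  linear_combination this

theorem up_down (hc : Contiguous p Q y hm h hp) (h0 : p ≠ 0) (hy : y ≠ 0) (hQ : Q ≠ 0) (n : ℕ) :
    Q * p ^ n * (hank n h * hank n (sh h)) - hank (n + 1) h * hankPred n h
      = Q * p ^ n * (hank n hp * hank n (sh hm)) := by
  cases n with
  | zero => simp [hankPred, hank_zero]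
  | succ n =>
    have := hank_identity_one_infinite n y 0 1 h
    rw [chr_comm 0 1, chr_zero_eq_sh, chr_comm y 1, chr_comm y 1, hc.hank_both,
      hc.shift.hank_both, hc.up, hc.shift.hank_down, gauge_succ] at this
    have hg := gauge_ne_zero h0 n
    simp only [hankPred]
    apply mul_left_cancel₀ (mul_ne_zero (pow_ne_zero (n + 1) (mul_ne_zero hy hQ))
      (mul_ne_zero hg (pow_ne_zero (2 * n) h0)))
    linear_combination Q * this

theorem down_up (hc : Contiguous p Q y hm h hp) (h0 : p ≠ 0) (hy : y ≠ 0) (hQ : Q ≠ 0) (n : ℕ) :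
    y * Q * p ^ n * (hank n h * hank n (sh h)) - hank (n + 1) h * hankPred n h
      = y * Q * (hank n hm * hank n (sh hp)) := by
  cases n with
  | zero => simp [hankPred, hank_zero]
  | succ n =>
    have := hank_identity_one_infinite n 1 0 y h
    rw [chr_comm 0 y, chr_zero_eq_sh, hc.hank_both, hc.shift.hank_both, hc.shift.up,
      hc.hank_down, gauge_succ] at this
    have hg := gauge_ne_zero h0 n
    simp only [hankPred]
    apply mul_left_cancel₀ (mul_ne_zero (pow_ne_zero n (mul_ne_zero hy hQ))
      (mul_ne_zero hg (pow_ne_zero (2 * n) h0)))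
    linear_combination this

/-- Both Hankel identities used contain the product of the determinants of h (size n + 2) and E²h
(size n), the first one because (E - 1)(E - y) reproduces h up to a geometric factor. Eliminating
this product leaves the claim. -/
theorem up_mul_down (hc : Contiguous p Q y hm h hp) (h0 : p ≠ 0) (hy : y ≠ 0) (hQ : Q ≠ 0)
    (n : ℕ) :
    Q * p * (hank n (sh hp) * hank n (sh hm)) - hank n (sh h) ^ 2
      = (Q * p - 1) * (hank n (sh (sh h)) * hank n h) := by
  cases n with
  | zero => simp [hank_zero]
  | succ n =>
    have h1 := hank_identity_finite n 0 y 1 0 h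
    have h2 := hank_identity_two_infinite n 0 0 h
    simp only [chr_zero_eq_sh] at h1 h2
    simp only [← chr_sh, chr_comm y 1] at h1
    rw [hc.shift.shift.hank_both, hc.hank_both, hc.shift.up, hc.shift.hank_down,
      gauge_succ] at h1
    have hg := gauge_ne_zero h0 n
    apply mul_left_cancel₀ (mul_ne_zero (pow_ne_zero (n + 1) (mul_ne_zero hy hQ))
      (mul_ne_zero hg (pow_ne_zero (3 * n) h0)))
    linear_combination -Q * h1 - Q ^ (n + 1) * y ^ (n + 1) * gauge p n * p ^ (3 * n) * h2

end Contiguous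

end Tau

/-! ### From bilinear relations to the Painlevé equations -/

section Equations

/-- The variables of the `q`-Painlevé equation in terms of tau functions, where `a = q ^ m`,
`b = q ^ n`. -/
noncomputable def tauVars (x a b A₀ A₁ B₀ B₁ C₀ C₁ : ℂ) : Vars where
  x := x
  a₁ := -a
  a₂ := b⁻¹
  f₁ := a * A₁ * B₀ / (b ^ 2 * A₀ * B₁)
  f₂ := -(b * B₁ * C₀ / (B₀ * C₁))

variable {x q a b A₀ A₁ A₂ B₀ B₁ B₂ C₀ C₁ C₂ X : ℂ}

/-- The auxiliary X, which may vanish, is eliminated between `h₁` and each of `h₂`, `h₃`. Each of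
the three trinomials then becomes a single product of tau functions. -/
theorem eqT_tauVars (hx : x ≠ 0) (hq : q ≠ 0) (ha : a ≠ 0) (hb : b ≠ 0)
    (hA₀ : A₀ ≠ 0) (hA₁ : A₁ ≠ 0) (hA₂ : A₂ ≠ 0) (hB₀ : B₀ ≠ 0) (hB₁ : B₁ ≠ 0) (hB₂ : B₂ ≠ 0)
    (hC₀ : C₀ ≠ 0) (hC₁ : C₁ ≠ 0) (hC₂ : C₂ ≠ 0)
    (h₁ : A₀ * X = B₀ * C₁ - B₁ * C₀)
    (h₂ : b ^ 2 * (B₁ * C₁) - a ^ 2 * (A₁ * X) = b ^ 2 * (B₂ * C₀))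
    (h₃ : x ^ 2 * q ^ 2 * b ^ 2 * (B₁ * C₁) - a ^ 2 * (A₁ * X) = x ^ 2 * q ^ 2 * (B₀ * C₂))
    (h₄ : (1 - x ^ 2 * q ^ 2) * b ^ 2 * a ^ 2 * A₁ * B₁ + x ^ 2 * q ^ 2 * b ^ 4 * A₀ * B₂
      = a ^ 2 * B₀ * A₂) :
    EqT q (tauVars x a b A₀ A₁ B₀ B₁ C₀ C₁) (tauVars (x * q) a b A₁ A₂ B₁ B₂ C₁ C₂) := by
  set P := tauVars x a b A₀ A₁ B₀ B₁ C₀ C₁ with hP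
  set S := tauVars (x * q) a b A₁ A₂ B₁ B₂ C₁ C₂ with hS
  have f0 : P.f q 0 = -(x ^ 2 * q * b * A₀ * C₁ / (a * A₁ * C₀)) := by
    simp [hP, Vars.f, tauVars]; field_simp
  have f1 : P.f q 1 = a * A₁ * B₀ / (b ^ 2 * A₀ * B₁) := rfl
  have f2 : P.f q 2 = -(b * B₁ * C₀ / (B₀ * C₁)) := rfl
  have g0 : S.f q 0 = -((x * q) ^ 2 * q * b * A₁ * C₂ / (a * A₂ * C₁)) := by
    simp [hS, Vars.f, tauVars]; field_simp
  have g1 : S.f q 1 = a * A₂ * B₁ / (b ^ 2 * A₁ * B₂) := rfl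
  have g2 : S.f q 2 = -(b * B₂ * C₁ / (B₁ * C₂)) := rfl
  have a0 : P.a q 0 = -(q * b / a) := by
    simp [hP, Vars.a, tauVars]; field_simp
  have a1 : P.a q 1 = -a := rfl
  have a2 : P.a q 2 = b⁻¹ := rfl
  have D1 : 1 + P.a q 1 * P.f q 1 + P.a q 1 * P.a q 2 * P.f q 1 * P.f q 2
      = B₂ * C₀ / (B₁ * C₁) := by
    rw [a1, a2, f1, f2]
    field_simp
    linear_combination A₀ * h₂ + a ^ 2 * A₁ * h₁
  have D2 : 1 + P.a q 2 * P.f q 2 + P.a q 2 * P.a q 0 * P.f q 2 * P.f q 0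
      = -(x ^ 2 * q ^ 2 * A₀ * C₂ / (a ^ 2 * A₁ * C₁)) := by
    rw [a0, a2, f0, f2]
    field_simp
    linear_combination -A₀ * h₃ - a ^ 2 * A₁ * h₁
  have D0 : 1 + P.a q 0 * P.f q 0 + P.a q 0 * P.a q 1 * P.f q 0 * P.f q 1
      = A₂ * B₀ / (b ^ 2 * A₁ * B₁) := by
    -- Since a₀a₁a₂f₀f₁f₂ = x²q², this trinomial reduces to the one in `D1`.
    have : 1 + P.a q 0 * P.f q 0 + P.a q 0 * P.a q 1 * P.f q 0 * P.f q 1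
        = 1 - x ^ 2 * q ^ 2 + P.a q 0 * P.f q 0 *
          (1 + P.a q 1 * P.f q 1 + P.a q 1 * P.a q 2 * P.f q 1 * P.f q 2) := by
      rw [a0, a1, a2, f0, f1, f2]
      field_simp
      ring
    rw [this, D1, a0, f0]
    field_simp
    linear_combination h₄
  refine ⟨rfl, rfl, rfl, fun j => ?_⟩
  fin_cases j
  · change IsQuotient (S.f q 0) (P.a q 0 * P.a q 1 * P.f q 1 *
      (1 + P.a q 2 * P.f q 2 + P.a q 2 * P.a q 0 * P.f q 2 * P.f q 0))
      (1 + P.a q 0 * P.f q 0 + P.a q 0 * P.a q 1 * P.f q 0 * P.f q 1)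
    rw [D2, D0, g0, a0, a1, f1]
    refine ⟨by positivity, ?_⟩
    field_simp
  · change IsQuotient (S.f q 1) (P.a q 1 * P.a q 2 * P.f q 2 *
      (1 + P.a q 0 * P.f q 0 + P.a q 0 * P.a q 1 * P.f q 0 * P.f q 1))
      (1 + P.a q 1 * P.f q 1 + P.a q 1 * P.a q 2 * P.f q 1 * P.f q 2)
    rw [D0, D1, g1, a1, a2, f2]
    refine ⟨by positivity, ?_⟩
    field_simp
  · change IsQuotient (S.f q 2) (P.a q 2 * P.a q 0 * P.f q 0 *
      (1 + P.a q 1 * P.f q 1 + P.a q 1 * P.a q 2 * P.f q 1 * P.f q 2))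
      (1 + P.a q 2 * P.f q 2 + P.a q 2 * P.a q 0 * P.f q 2 * P.f q 0)
    rw [D1, D2, g2, a2, a0, f0]
    refine ⟨by simp [*], ?_⟩
    field_simp

/-- `A'`, `A`, `B` are the tau functions of sizes `n + 2`, `n + 1`, `n`, and `G`, `C` those of
sizes `n + 1`, `n` for the shifted sequence. -/
theorem eqT₂_tauVars {A'₀ A'₁ G₀ G₁ : ℂ} (hx : x ≠ 0) (hq : q ≠ 0) (ha : a ≠ 0) (hb : b ≠ 0)
    (hA₀ : A₀ ≠ 0) (hA₁ : A₁ ≠ 0) (hB₀ : B₀ ≠ 0) (hB₁ : B₁ ≠ 0)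
    (hA'₀ : A'₀ ≠ 0) (hA'₁ : A'₁ ≠ 0) (hG₀ : G₀ ≠ 0) (hG₁ : G₁ ≠ 0)
    (h₁ : C₀ * A₁ + x ^ 2 * C₁ * A₀ = B₁ * G₀)
    (h₂ : x ^ 2 * q ^ 2 * b ^ 4 * C₁ * A₀ + a ^ 2 * b ^ 2 * C₀ * A₁ = a ^ 2 * B₀ * G₁)
    (h₃ : A'₀ * C₁ = A₀ * G₁ - A₁ * G₀)
    (h₄ : a ^ 2 * A'₁ * C₀ = x ^ 2 * q ^ 2 * b ^ 2 * (b ^ 2 * q ^ 2 * A₁ * G₀ - A₀ * G₁)) :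
    EqT₂ (tauVars x a (b * q) A'₀ A'₁ A₀ A₁ G₀ G₁) (tauVars x a b A₀ A₁ B₀ B₁ C₀ C₁) := by
  set P := tauVars x a (b * q) A'₀ A'₁ A₀ A₁ G₀ G₁ with hP
  have f1 : P.f₁ = a * A'₁ * A₀ / ((b * q) ^ 2 * A'₀ * A₁) := rfl
  have f2 : P.f₂ = -(b * q * A₁ * G₀ / (A₀ * G₁)) := rfl
  have a1 : P.a₁ = -a := rfl
  have a2 : P.a₂ = (b * q)⁻¹ := rfl
  have hN : P.a₁ * P.a₂ ^ 2 + P.f₁ + P.a₁ * P.a₂ * P.f₂ + P.a₂ * P.f₁ * P.f₂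
      = a ^ 3 * A'₁ * B₀ / (x ^ 2 * q ^ 4 * b ^ 6 * A₀ * A₁) := by
    rw [f1, f2, a1, a2]
    field_simp
    linear_combination -b ^ 2 * A'₀ * A₁ * h₄ - b ^ 4 * q ^ 2 * x ^ 2 * A₀ * A'₁ * h₃ + A'₀ * A'₁ * h₂
  have hD : P.a₂ + P.a₁ * P.a₂ * P.f₁ + P.f₂ + P.a₁ * P.a₂ ^ 2 * P.f₁ * P.f₂
      = -(a ^ 2 * A'₁ * B₁ * G₀ / (x ^ 2 * q ^ 3 * b ^ 3 * G₁ * A₀ * A₁)) := by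
    rw [f1, f2, a1, a2]
    field_simp
    linear_combination A'₀ * A₁ * h₄ + x ^ 2 * a ^ 2 * A₀ * A'₁ * h₃ - A'₀ * A'₁ * a ^ 2 * h₁
  rw [EqT₂, hN, hD, f2]
  refine ⟨by simp [*], ?_⟩
  simp only [tauVars]
  field_simp

theorem eqT₂Inv_tauVars {A'₀ A'₁ G₀ G₁ : ℂ} (hq : q ≠ 0) (ha : a ≠ 0) (hb : b ≠ 0)
    (hA₀ : A₀ ≠ 0) (hA₁ : A₁ ≠ 0) (hB₀ : B₀ ≠ 0) (hB₁ : B₁ ≠ 0)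
    (hC₀ : C₀ ≠ 0) (hC₁ : C₁ ≠ 0) (hG₀ : G₀ ≠ 0) (hG₁ : G₁ ≠ 0)
    (h₁ : C₀ * A₁ + x ^ 2 * C₁ * A₀ = B₁ * G₀)
    (h₂ : x ^ 2 * q ^ 2 * b ^ 4 * C₁ * A₀ + a ^ 2 * b ^ 2 * C₀ * A₁ = a ^ 2 * B₀ * G₁) :
    EqT₂Inv q (tauVars x a b A₀ A₁ B₀ B₁ C₀ C₁) (tauVars x a (b * q) A'₀ A'₁ A₀ A₁ G₀ G₁) := by
  set P := tauVars x a b A₀ A₁ B₀ B₁ C₀ C₁ with hP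
  have f12 : P.f₁ * P.f₂ = -(a * A₁ * C₀ / (b * A₀ * C₁)) := by
    simp only [hP, tauVars]; field_simp
  have a12 : P.a₁ * P.a₂ = -(a / b) := by
    simp only [hP, tauVars]; field_simp
  have hx' : P.x = x := rfl
  have hN : P.a₁ * P.a₂ * P.x ^ 2 + P.f₁ * P.f₂ = -(a * B₁ * G₀ / (b * A₀ * C₁)) := by
    rw [f12, a12, hx']; field_simp; linear_combination -h₁
  have hD : P.x ^ 2 * q ^ 2 + P.a₁ * P.a₂ * P.f₁ * P.f₂
      = a ^ 2 * B₀ * G₁ / (b ^ 4 * A₀ * C₁) := by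
    rw [mul_assoc (P.a₁ * P.a₂), f12, a12, hx']; field_simp; linear_combination h₂
  rw [EqT₂Inv, hN, hD]
  refine ⟨by simp [*], ?_⟩
  simp only [hP, tauVars]
  field_simp

/-- `Ah`, `Bh` are the tau functions with `m + 1` in place of `m`. -/
theorem eqT₁_tauVars {Bm X₀ Ah₀ Ah₁ Bh₀ Bh₁ : ℂ} (hx : x ≠ 0) (ha : a ≠ 0) (hb : b ≠ 0)
    (ha₂ : a ^ 2 ≠ 1)
    (hA₀ : A₀ ≠ 0) (hA₁ : A₁ ≠ 0) (hB₀ : B₀ ≠ 0) (hB₁ : B₁ ≠ 0)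
    (hC₀ : C₀ ≠ 0) (hC₁ : C₁ ≠ 0) (hBh₀ : Bh₀ ≠ 0)
    (h₁ : A₀ * X = B₀ * C₁ - B₁ * C₀)
    (h₂ : b ^ 2 * (B₁ * C₁) - a ^ 2 * (A₁ * X) = b ^ 2 * (B₂ * C₀))
    (h₃ : B₂ * B₀ - a ^ 2 * B₁ ^ 2 = (1 - a ^ 2) * (C₁ * Bh₁))
    (h₄ : a ^ 2 * (A₁ * X₀) = x ^ 2 * b ^ 2 * (b ^ 2 * B₁ * C₀ - B₀ * C₁))
    (h₅ : x ^ 2 * b ^ 2 * (B₀ * C₀) - a ^ 2 * (A₀ * X₀) = x ^ 2 * (Bm * C₁))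
    (h₆ : B₁ * Bm - a ^ 2 * B₀ ^ 2 = (1 - a ^ 2) * (C₀ * Bh₀)) :
    EqT₁ (tauVars x a b A₀ A₁ B₀ B₁ C₀ C₁) (tauVars x (a * q) b Ah₀ Ah₁ Bh₀ Bh₁ B₀ B₁) := by
  set P := tauVars x a b A₀ A₁ B₀ B₁ C₀ C₁ with hP
  have f1 : P.f₁ = a * A₁ * B₀ / (b ^ 2 * A₀ * B₁) := rfl
  have f2 : P.f₂ = -(b * B₁ * C₀ / (B₀ * C₁)) := rfl
  have a1 : P.a₁ = -a := rfl
  have a2 : P.a₂ = b⁻¹ := rfl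
  have hN : 1 + P.a₁ * P.f₁ + P.a₁ ^ 2 * P.a₂ * P.f₂ + P.a₁ * P.a₂ * P.f₁ * P.f₂
      = (1 - a ^ 2) * C₀ * Bh₁ / (B₀ * B₁) := by
    rw [f1, f2, a1, a2]
    field_simp
    linear_combination A₀ * B₀ * h₂ + a ^ 2 * A₁ * B₀ * h₁ + b ^ 2 * C₀ * A₀ * h₃
  have hD : P.a₁ * P.a₂ + P.a₁ * P.f₂ + P.a₁ ^ 2 * P.a₂ * P.f₁ + P.f₁ * P.f₂
      = -(a * (1 - a ^ 2) * A₁ * C₀ * Bh₀ / (b ^ 3 * A₀ * B₀ * B₁)) := by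
    rw [f1, f2, a1, a2]
    field_simp
    -- The relations `h₄` and `h₅`, between which X₀ is eliminated, carry a factor x².
    apply mul_left_cancel₀ (pow_ne_zero 2 hx)
    linear_combination -A₀ * B₁ * h₄ - A₁ * B₁ * h₅ - x ^ 2 * A₁ * C₁ * h₆
  -- Numerator and denominator share this factor, so both vanish when a² = 1.
  have ha' : 1 - a ^ 2 ≠ 0 := sub_ne_zero.2 ha₂.symm
  rw [EqT₁, hN, hD, f1]
  refine ⟨by simp [*], ?_⟩
  simp only [tauVars]
  field_simp

theorem eqT₁Inv_tauVars {Ah₀ Ah₁ Bh₀ Bh₁ : ℂ} (hq : q ≠ 0) (ha : a ≠ 0) (hb : b ≠ 0)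
    (hA₀ : A₀ ≠ 0) (hB₀ : B₀ ≠ 0) (hB₁ : B₁ ≠ 0)
    (hAh₀ : Ah₀ ≠ 0) (hBh₀ : Bh₀ ≠ 0) (hBh₁ : Bh₁ ≠ 0)
    (h₁ : B₀ * Ah₁ + x ^ 2 * B₁ * Ah₀ = Bh₁ * A₀)
    (h₂ : x ^ 2 * b ^ 4 * B₁ * Ah₀ + a ^ 2 * b ^ 2 * B₀ * Ah₁ = a ^ 2 * Bh₀ * A₁) :
    EqT₁Inv q (tauVars x (a * q) b Ah₀ Ah₁ Bh₀ Bh₁ B₀ B₁) (tauVars x a b A₀ A₁ B₀ B₁ C₀ C₁) := by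
  set P := tauVars x (a * q) b Ah₀ Ah₁ Bh₀ Bh₁ B₀ B₁ with hP
  have f12 : P.f₁ * P.f₂ = -(a * q * Ah₁ * B₀ / (b * Ah₀ * B₁)) := by
    simp only [hP, tauVars]; field_simp
  have a12 : P.a₁ * P.a₂ = -(a * q / b) := by
    simp only [hP, tauVars]; field_simp
  have hx' : P.x = x := rfl
  have hD : P.x ^ 2 * P.a₁ * P.a₂ + P.f₁ * P.f₂ = -(a * q * Bh₁ * A₀ / (b * Ah₀ * B₁)) := by
    rw [mul_assoc (P.x ^ 2), f12, a12, hx']; field_simp; linear_combination -h₁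
  have hN : P.x ^ 2 * q ^ 2 + P.a₁ * P.a₂ * P.f₁ * P.f₂
      = a ^ 2 * q ^ 2 * Bh₀ * A₁ / (b ^ 4 * Ah₀ * B₁) := by
    rw [mul_assoc (P.a₁ * P.a₂), f12, a12, hx']; field_simp; linear_combination h₂
  rw [EqT₁Inv, hN, hD]
  refine ⟨by simp [*], ?_⟩
  simp only [hP, tauVars]
  field_simp

end Equations

open Filter Topology

/-! ### The infinite q-shifted factorial -/

section Pochhammer

/-- The infinite `q`-shifted factorial `(z; p)_∞`. -/
noncomputable def poch (p z : ℂ) : ℂ := ∏' j : ℕ, (1 - z * p ^ j)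

variable {p : ℂ}

theorem summable_norm_mul_pow (hp : ‖p‖ < 1) (z : ℂ) : Summable fun j : ℕ => ‖-(z * p ^ j)‖ := by
  simpa using (summable_geometric_of_lt_one (norm_nonneg p) hp).mul_left ‖z‖

theorem multipliable_poch (hp : ‖p‖ < 1) (z : ℂ) : Multipliable fun j : ℕ => 1 - z * p ^ j := by
  simp_rw [sub_eq_add_neg]
  exact multipliable_one_add_of_summable (summable_norm_mul_pow hp z)

theorem poch_eq (hp : ‖p‖ < 1) (z : ℂ) : poch p z = (1 - z) * poch p (z * p) := by
  have h : (fun j : ℕ => 1 - z * p ^ (j + 1)) = fun j => 1 - z * p * p ^ j := by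
    funext j; ring
  have hm : Multipliable fun j : ℕ => 1 - z * p ^ (j + 1) := by
    rw [h]; exact multipliable_poch hp _
  have key := tprod_eq_zero_mul' (f := fun j : ℕ => 1 - z * p ^ j) hm
  rw [h, pow_zero, mul_one] at key
  exact key

theorem poch_ne_zero (hp : ‖p‖ < 1) {z : ℂ} (hz : ∀ j : ℕ, z * p ^ j ≠ 1) : poch p z ≠ 0 := by
  simp only [poch, sub_eq_add_neg]
  refine tprod_one_add_ne_zero_of_summable (fun j => ?_) (summable_norm_mul_pow hp z)
  rw [← sub_eq_add_neg, sub_ne_zero]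
  exact (hz j).symm

@[simp] theorem poch_zero (p : ℂ) : poch p 0 = 1 := by simp [poch]

theorem norm_poch_le (hp : ‖p‖ < 1) {z : ℂ} {M : ℝ} (hz : ‖z‖ ≤ M) :
    ‖poch p z‖ ≤ Real.exp (M / (1 - ‖p‖)) := by
  have hsum := summable_geometric_of_lt_one (norm_nonneg p) hp
  refine le_of_tendsto (multipliable_poch hp z).tendsto_prod_tprod_nat.norm
    (Eventually.of_forall fun n => ?_)
  rw [norm_prod]
  calc ∏ j ∈ Finset.range n, ‖1 - z * p ^ j‖
      ≤ ∏ j ∈ Finset.range n, Real.exp (M * ‖p‖ ^ j) := by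
        refine Finset.prod_le_prod (fun _ _ => norm_nonneg _) fun j _ => ?_
        calc ‖1 - z * p ^ j‖ ≤ ‖(1 : ℂ)‖ + ‖z * p ^ j‖ := norm_sub_le _ _
          _ ≤ M * ‖p‖ ^ j + 1 := by
            rw [norm_one, norm_mul, norm_pow, add_comm]
            gcongr
          _ ≤ _ := Real.add_one_le_exp _
    _ = Real.exp (∑ j ∈ Finset.range n, M * ‖p‖ ^ j) := (Real.exp_sum _ _).symm
    _ ≤ _ := by
        have hM : 0 ≤ M := (norm_nonneg z).trans hz
        apply Real.exp_le_exp.2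
        rw [← Finset.mul_sum, div_eq_mul_inv, ← tsum_geometric_of_lt_one (norm_nonneg p) hp]
        gcongr
        exact hsum.sum_le_tsum _ fun _ _ => by positivity

theorem differentiable_poch (hp : ‖p‖ < 1) : Differentiable ℂ (poch p) := by
  intro z
  have hu : Summable fun j : ℕ => (‖z‖ + 1) * ‖p‖ ^ j :=
    (summable_geometric_of_lt_one (norm_nonneg p) hp).mul_left _
  have h := (hu.hasProdLocallyUniformlyOn_nat_one_add (K := Metric.ball (0 : ℂ) (‖z‖ + 1))
    (f := fun j x => -(x * p ^ j)) Metric.isOpen_ball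
    (Eventually.of_forall fun j x hx => by
      rw [norm_neg, norm_mul, norm_pow]
      gcongr
      simpa using (mem_ball_zero_iff.1 hx).le)
    (fun j => by fun_prop)).differentiableOn
    (Eventually.of_forall fun s => by
      simpa [Finset.prod_fn] using DifferentiableOn.finsetProd (fun _ _ => by fun_prop))
    Metric.isOpen_ball
  have h2 : DifferentiableOn ℂ (poch p) (Metric.ball (0 : ℂ) (‖z‖ + 1)) := by
    have : poch p = fun x => ∏' j : ℕ, (1 + -(x * p ^ j)) := by
      funext x; simp only [poch, sub_eq_add_neg]
    rw [this]; exact h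
  exact h2.differentiableAt (Metric.isOpen_ball.mem_nhds (by simp))

end Pochhammer

/-! ### Growth estimates with triangular exponents -/

section Triangular

/-- The power of `p` with exponent `n (n - 1) / 2`. -/
noncomputable def tri (p : ℂ) (n : ℤ) : ℂ := p ^ (n * (n - 1) / 2)

variable {p : ℂ}

@[simp] theorem tri_zero (p : ℂ) : tri p 0 = 1 := by simp [tri]

theorem tri_add_one (h0 : p ≠ 0) (n : ℤ) : tri p (n + 1) = tri p n * p ^ n := by
  rw [tri, tri, ← zpow_add₀ h0]
  congr 1
  rw [show (n + 1) * (n + 1 - 1) = n * (n - 1) + n * 2 by ring,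
    Int.add_mul_ediv_right _ _ two_ne_zero]

theorem tri_neg (p : ℂ) (n : ℤ) : tri p (-n) = tri p (n + 1) := by
  rw [tri, tri]; congr 2; ring

theorem tri_natCast (h0 : p ≠ 0) (k : ℕ) : tri p k = p ^ (k.choose 2) := by
  induction k with
  | zero => simp
  | succ k ih =>
    rw [Nat.cast_succ, tri_add_one h0, ih, zpow_natCast, ← pow_add, Nat.choose_succ_succ',
      Nat.choose_one_right, add_comm]

theorem norm_tri_mul_poch_natCast_le (hp : ‖p‖ < 1) (h0 : p ≠ 0) {z : ℂ} {M : ℝ} (hz : ‖z‖ ≤ M)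
    (k : ℕ) :
    ‖tri p k * poch p (z * p ^ (k : ℤ))‖ ≤ Real.exp (M / (1 - ‖p‖)) * ‖p‖ ^ (k.choose 2) := by
  have : ‖z * p ^ (k : ℤ)‖ ≤ M := by
    rw [zpow_natCast, norm_mul, norm_pow]
    calc ‖z‖ * ‖p‖ ^ k ≤ ‖z‖ * 1 := by
          gcongr; exact pow_le_one₀ (norm_nonneg _) hp.le
      _ ≤ M := by simpa using hz
  rw [norm_mul, tri_natCast h0, norm_pow, mul_comm]
  gcongr
  exact norm_poch_le hp this

theorem norm_tri_mul_poch_neg_natCast_le (hp : ‖p‖ < 1) (h0 : p ≠ 0) {z : ℂ} {M : ℝ}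
    (hz : ‖z‖ ≤ M) (k : ℕ) :
    ‖tri p (-k) * poch p (z * p ^ (-k : ℤ))‖ ≤ Real.exp (M / (1 - ‖p‖)) * (1 + M) ^ k := by
  induction k with
  | zero => simpa using norm_poch_le hp hz
  | succ k ih =>
    have h1 : tri p (-k) = tri p (-(k + 1 : ℕ)) * p ^ (-(k + 1 : ℕ) : ℤ) := by
      rw [← tri_add_one h0]; congr 1; push_cast; ring
    have h2 : p ^ (-k : ℤ) = p ^ (-(k + 1 : ℕ) : ℤ) * p := by
      rw [← zpow_add_one₀ h0]; congr 1; push_cast; ring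
    have h3 : p ^ (-(k + 1 : ℕ) : ℤ) * p ^ (k + 1) = 1 := by
      rw [← zpow_natCast, ← zpow_add₀ h0]; simp
    -- Going down by one index brings in the factor 1 - z p^(-(k+1)), which grows, but p^(k+1) from
    -- `tri` turns it into p^(k+1) - z, of norm at most 1 + M.
    have h4 : tri p (-(k + 1 : ℕ)) * poch p (z * p ^ (-(k + 1 : ℕ) : ℤ))
        = (p ^ (k + 1) - z) * (tri p (-k) * poch p (z * p ^ (-k : ℤ))) := by
      rw [poch_eq hp, mul_assoc z, ← h2, h1]
      linear_combination -tri p (-(k + 1 : ℕ)) * poch p (z * p ^ (-k : ℤ)) * h3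
    rw [h4, norm_mul, pow_succ]
    have h5 : ‖p ^ (k + 1) - z‖ ≤ 1 + M := by
      refine (norm_sub_le _ _).trans (add_le_add ?_ hz)
      rw [norm_pow]
      exact pow_le_one₀ (norm_nonneg _) hp.le
    calc ‖p ^ (k + 1) - z‖ * ‖tri p (-k) * poch p (z * p ^ (-k : ℤ))‖
        ≤ (1 + M) * (Real.exp (M / (1 - ‖p‖)) * (1 + M) ^ k) := by
          gcongr
          exact (norm_nonneg _).trans h5
      _ = _ := by ring

/-- For either sign of n one factor decays like |p|^(n choose 2), with |n| for n, while the other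
grows at most geometrically. -/
theorem norm_tri_poch_mul_tri_poch_le (hp : ‖p‖ < 1) (h0 : p ≠ 0) {z z' : ℂ} {M : ℝ}
    (hz : ‖z‖ ≤ M) (hz' : ‖z'‖ ≤ M) (n : ℤ) :
    ‖(tri p n * poch p (z * p ^ n)) * (tri p (-n) * poch p (z' * p ^ (-n)))‖
      ≤ Real.exp (M / (1 - ‖p‖)) ^ 2 * ((1 + M) ^ n.natAbs * ‖p‖ ^ (n.natAbs.choose 2)) := by
  have hM : 0 ≤ M := (norm_nonneg z).trans hz
  obtain ⟨k, rfl | rfl⟩ := n.eq_nat_or_neg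
  · rw [norm_mul, Int.natAbs_natCast]
    refine (mul_le_mul (norm_tri_mul_poch_natCast_le hp h0 hz k)
      (norm_tri_mul_poch_neg_natCast_le hp h0 hz' k) (norm_nonneg _) (by positivity)).trans_eq ?_
    ring
  · rw [norm_mul, neg_neg, Int.natAbs_neg, Int.natAbs_natCast]
    refine (mul_le_mul (norm_tri_mul_poch_neg_natCast_le hp h0 hz k)
      (norm_tri_mul_poch_natCast_le hp h0 hz' k) (norm_nonneg _) (by positivity)).trans_eq ?_
    ring

theorem summable_pow_mul_pow_choose {L r : ℝ} (hL : 0 ≤ L) (hr : 0 < r) (hr1 : r < 1) :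
    Summable fun k : ℕ => L ^ k * r ^ (k.choose 2) := by
  rcases hL.eq_or_lt with rfl | hL
  · refine summable_of_ne_finset_zero (s := {0}) fun k hk => ?_
    simp at hk
    simp [hk]
  · have hpos : ∀ k : ℕ, 0 < L ^ k * r ^ (k.choose 2) := fun k => by positivity
    refine summable_of_ratio_test_tendsto_lt_one (l := 0) one_pos
      (Eventually.of_forall fun k => (hpos k).ne') ?_
    have : (fun k : ℕ => ‖L ^ (k + 1) * r ^ ((k + 1).choose 2)‖ / ‖L ^ k * r ^ (k.choose 2)‖)
        = fun k => L * r ^ k := by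
      funext k
      rw [Real.norm_of_nonneg (hpos _).le, Real.norm_of_nonneg (hpos _).le,
        div_eq_iff (hpos k).ne', Nat.choose_succ_succ', Nat.choose_one_right]
      ring
    rw [this]
    simpa using (tendsto_pow_atTop_nhds_zero_of_lt_one hr.le hr1).const_mul L

theorem summable_int_pow_mul_pow_choose {L r : ℝ} (hL : 0 ≤ L) (hr : 0 < r) (hr1 : r < 1) :
    Summable fun n : ℤ => L ^ n.natAbs * r ^ (n.natAbs.choose 2) :=
  Summable.of_nat_of_neg (by simpa using summable_pow_mul_pow_choose hL hr hr1)
    (by simpa using summable_pow_mul_pow_choose hL hr hr1)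

theorem norm_zpow_le {z : ℂ} {M : ℝ} (hz : ‖z‖ ≤ M) (hz' : ‖z⁻¹‖ ≤ M) (n : ℤ) :
    ‖z ^ n‖ ≤ M ^ n.natAbs := by
  obtain ⟨k, rfl | rfl⟩ := n.eq_nat_or_neg
  · rw [zpow_natCast, norm_pow, Int.natAbs_natCast]; gcongr
  · rw [zpow_neg, ← inv_zpow, zpow_natCast, norm_pow, Int.natAbs_neg, Int.natAbs_natCast]; gcongr

end Triangular

/-! ### Quasi-periodicity and zeros of the theta product -/

section ThetaProduct

variable {p : ℂ}

/-- The theta function in product form. -/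
noncomputable def thetaProd (p z : ℂ) : ℂ := poch p z * poch p (p / z)

theorem thetaProd_mul (hp : ‖p‖ < 1) (h0 : p ≠ 0) {z : ℂ} (hz : z ≠ 0) :
    thetaProd p (z * p) * -z = thetaProd p z := by
  have h1 : p / (z * p) = 1 / z := by field_simp
  rw [thetaProd, thetaProd, h1, poch_eq hp z, poch_eq hp (1 / z)]
  rw [show 1 / z * p = p / z by ring]
  field_simp
  ring

theorem thetaProd_mul_zpow (hp : ‖p‖ < 1) (h0 : p ≠ 0) {z : ℂ} (hz : z ≠ 0) (n : ℤ) :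
    thetaProd p (z * p ^ n) * (tri p n * (-z) ^ n) = thetaProd p z := by
  have hstep : ∀ n : ℤ, thetaProd p (z * p ^ (n + 1)) * (tri p (n + 1) * (-z) ^ (n + 1))
      = thetaProd p (z * p ^ n) * (tri p n * (-z) ^ n) := by
    intro n
    rw [← thetaProd_mul hp h0 (mul_ne_zero hz (zpow_ne_zero n h0)), tri_add_one h0,
      zpow_add_one₀ h0, zpow_add_one₀ (neg_ne_zero.2 hz), mul_assoc z]
    ring
  induction n with
  | zero => simp
  | succ n ih => rw [hstep, ih]
  | pred n ih => rw [← ih, ← hstep (-n - 1), sub_add_cancel]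

theorem thetaProd_ne_zero (hp : ‖p‖ < 1) (h0 : p ≠ 0) {z : ℂ} (hz : z ≠ 0)
    (h : ∀ n : ℤ, z * p ^ n ≠ 1) : thetaProd p z ≠ 0 := by
  refine mul_ne_zero (poch_ne_zero hp fun j => by simpa using h j) (poch_ne_zero hp fun j hj => ?_)
  apply h (-(j + 1 : ℕ))
  rw [zpow_neg, zpow_natCast, ← div_eq_mul_inv, div_eq_one_iff_eq (pow_ne_zero _ h0), pow_succ']
  field_simp at hj
  exact hj.symm

end ThetaProduct

/-! ### The bilateral series and its contiguity relations -/

section Series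

variable {p w a X : ℂ}

/-- The coefficients of the theta function. -/
noncomputable def thetaCoeff (p w : ℂ) (n : ℤ) : ℂ := (-w) ^ n * tri p (n + 1)

/-- The quotient of infinite products in the definition of `μ`. -/
noncomputable def pochQuot (p a X : ℂ) (n : ℤ) : ℂ :=
  poch p (X * p * p ^ n) / poch p (X * p * p ^ n * a)

/-- The bilateral series in the definition of `μ`, where `a = p ^ (-α)`. -/
noncomputable def qSeries (p w a X : ℂ) : ℂ := ∑' n : ℤ, thetaCoeff p w n * pochQuot p a X n

/-- The terms of the series `qSeries` multiplied by a theta function which cancels its poles. -/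
noncomputable def entireTerm (p w a X : ℂ) (n : ℤ) : ℂ :=
  (-w) ^ n * (-(X * a * p)) ^ n * ((tri p n * poch p (X * p * p ^ n)) *
    (tri p (-n) * poch p ((X * a)⁻¹ * p ^ (-n))))

/-- The series `qSeries` multiplied by a theta function which cancels its poles. -/
noncomputable def entireSeries (p w a X : ℂ) : ℂ := ∑' n : ℤ, entireTerm p w a X n

theorem thetaCoeff_add_one (h0 : p ≠ 0) (hw : w ≠ 0) (n : ℤ) :
    thetaCoeff p w (n + 1) = -w * (thetaCoeff p w n * p ^ (n + 1)) := by
  rw [thetaCoeff, thetaCoeff, tri_add_one h0 (n + 1), zpow_add_one₀ (neg_ne_zero.2 hw)]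
  ring

theorem norm_entireTerm_le (hp : ‖p‖ < 1) (h0 : p ≠ 0) (w a : ℂ) (M : ℝ)
    (hM : 0 ≤ M) : ∃ C L : ℝ, 0 ≤ L ∧ ∀ X : ℂ, ‖X‖ ≤ M → ‖X⁻¹‖ ≤ M → ∀ n : ℤ,
      ‖entireTerm p w a X n‖ ≤ C * (L ^ n.natAbs * ‖p‖ ^ (n.natAbs.choose 2)) := by
  set W := ‖w‖ + ‖w⁻¹‖ with hW
  set A := M * (‖a * p‖ + ‖(a * p)⁻¹‖) with hA
  set Z := M * (‖p‖ + ‖a⁻¹‖) with hZ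
  refine ⟨Real.exp (Z / (1 - ‖p‖)) ^ 2, W * A * (1 + Z), by positivity, fun X hX hX' n => ?_⟩
  have h1 : ‖(-w) ^ n‖ ≤ W ^ n.natAbs :=
    norm_zpow_le (by rw [norm_neg]; simp [hW]) (by rw [inv_neg, norm_neg]; simp [hW]) n
  have h2 : ‖(-(X * a * p)) ^ n‖ ≤ A ^ n.natAbs := by
    refine norm_zpow_le ?_ ?_ n
    · rw [norm_neg, mul_assoc, norm_mul, hA]
      exact mul_le_mul hX (le_add_of_nonneg_right (norm_nonneg _)) (norm_nonneg _) hM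
    · rw [inv_neg, norm_neg, mul_assoc, mul_inv, norm_mul, hA]
      exact mul_le_mul hX' (le_add_of_nonneg_left (norm_nonneg _)) (norm_nonneg _) hM
  have h3 := norm_tri_poch_mul_tri_poch_le hp h0 (z := X * p) (z' := (X * a)⁻¹) (M := Z)
    (by rw [norm_mul, hZ]; exact mul_le_mul hX (by simp) (norm_nonneg _) hM)
    (by rw [mul_inv, norm_mul, hZ]; exact mul_le_mul hX' (by simp) (norm_nonneg _) hM) n
  rw [entireTerm, norm_mul, norm_mul]
  refine (mul_le_mul (mul_le_mul h1 h2 (norm_nonneg _) (by positivity)) h3 (norm_nonneg _)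
    (by positivity)).trans_eq ?_
  clear_value W A Z
  rw [mul_pow, mul_pow]
  ring

theorem summable_entireTerm (hp : ‖p‖ < 1) (h0 : p ≠ 0) (w a X : ℂ) :
    Summable (entireTerm p w a X) := by
  obtain ⟨C, L, hL, h⟩ := norm_entireTerm_le hp h0 w a (‖X‖ + ‖X⁻¹‖) (by positivity)
  exact Summable.of_norm_bounded
    ((summable_int_pow_mul_pow_choose hL (norm_pos_iff.2 h0) hp).mul_left C)
    (h X (by simp) (by simp))

theorem differentiableAt_entireSeries (hp : ‖p‖ < 1) (h0 : p ≠ 0) (w : ℂ) (ha : a ≠ 0)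
    (hX : X ≠ 0) : DifferentiableAt ℂ (entireSeries p w a) X := by
  set M := ‖X‖ + ‖X⁻¹‖ + 1 with hM
  obtain ⟨C, L, hL, h⟩ := norm_entireTerm_le hp h0 w a M (by positivity)
  -- An annulus around X on which both X and its inverse are bounded by M, so that the majorant of
  -- the terms is uniform.
  set U : Set ℂ := {Y | Y ≠ 0} ∩ {Y | ‖Y‖ < M} ∩ {Y | 1 < M * ‖Y‖} with hU
  have hUo : IsOpen U := (isOpen_ne.inter (isOpen_lt continuous_norm continuous_const)).inter
    (isOpen_lt continuous_const (continuous_const.mul continuous_norm))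
  have hXU : X ∈ U := by
    refine ⟨⟨hX, ?_⟩, ?_⟩
    · have := norm_nonneg X⁻¹
      simp only [Set.mem_ofPred_eq, hM]; linarith
    · have h1 : 0 < ‖X‖ := norm_pos_iff.2 hX
      have h2 : ‖X⁻¹‖ * ‖X‖ = 1 := by rw [← norm_mul, inv_mul_cancel₀ hX, norm_one]
      simp only [Set.mem_ofPred_eq, hM]
      nlinarith
  refine (Complex.differentiableOn_tsum_of_summable_norm
    ((summable_int_pow_mul_pow_choose hL (norm_pos_iff.2 h0) hp).mul_left C)
    (fun n => ?_) hUo (fun n Y hY => h Y hY.1.2.le ?_ n)).differentiableAt (hUo.mem_nhds hXU)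
  · intro Y hY
    have hY0 : Y ≠ 0 := hY.1.1
    apply DifferentiableAt.differentiableWithinAt
    have e1 : DifferentiableAt ℂ (fun Y : ℂ => (-(Y * a * p)) ^ n) Y :=
      DifferentiableAt.zpow (by fun_prop)
        (Or.inl (neg_ne_zero.2 (mul_ne_zero (mul_ne_zero hY0 ha) h0)))
    have e2 : DifferentiableAt ℂ (fun Y : ℂ => poch p (Y * p * p ^ n)) Y :=
      (differentiable_poch hp).differentiableAt.comp Y (by fun_prop)
    have e3 : DifferentiableAt ℂ (fun Y : ℂ => poch p ((Y * a)⁻¹ * p ^ (-n))) Y :=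
      have e4 : DifferentiableAt ℂ (fun Y : ℂ => Y * a) Y := by fun_prop
      (differentiable_poch hp).differentiableAt.comp Y
        ((e4.fun_inv (mul_ne_zero hY0 ha)).mul_const _)
    unfold entireTerm
    fun_prop
  · have hY0 : 0 < ‖Y‖ := norm_pos_iff.2 hY.1.1
    rw [norm_inv, inv_le_iff_one_le_mul₀ hY0]
    exact le_of_lt hY.2

theorem poch_ne_zero_of_forall (hp : ‖p‖ < 1) (h0 : p ≠ 0) (h : ∀ n : ℤ, X * a * p ^ n ≠ 1)
    (n : ℤ) : poch p (X * p * p ^ n * a) ≠ 0 := by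
  refine poch_ne_zero hp fun j hj => h (1 + n + j) ?_
  rw [← hj, zpow_add₀ h0, zpow_add₀ h0, zpow_one, zpow_natCast]
  ring

theorem mul_ne_zero_of_forall (hX : X ≠ 0) (ha : a ≠ 0) (h0 : p ≠ 0) : X * a * p ≠ 0 :=
  mul_ne_zero (mul_ne_zero hX ha) h0

/-- Quasi-periodicity moves the argument of theta to X a p^(n+1), where its first factor is exactly
the denominator of the quotient. -/
theorem pochQuot_mul_thetaProd (hp : ‖p‖ < 1) (h0 : p ≠ 0) (ha : a ≠ 0) (hX : X ≠ 0)
    (h : ∀ n : ℤ, X * a * p ^ n ≠ 1) (n : ℤ) :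
    pochQuot p a X n * thetaProd p (X * a * p) = (-(X * a * p)) ^ n *
      ((tri p n * poch p (X * p * p ^ n)) * poch p ((X * a)⁻¹ * p ^ (-n))) := by
  have hne := poch_ne_zero_of_forall hp h0 h n
  have e1 : p / (X * a * p * p ^ n) = (X * a)⁻¹ * p ^ (-n) := by
    rw [zpow_neg]; field_simp
  have e2 : X * a * p * p ^ n = X * p * p ^ n * a := by ring
  rw [← thetaProd_mul_zpow hp h0 (mul_ne_zero_of_forall hX ha h0) n, pochQuot, thetaProd, e1, e2]
  field_simp

theorem term_mul_thetaProd (hp : ‖p‖ < 1) (h0 : p ≠ 0) (ha : a ≠ 0) (hX : X ≠ 0)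
    (h : ∀ n : ℤ, X * a * p ^ n ≠ 1) (n : ℤ) :
    thetaCoeff p w n * pochQuot p a X n * thetaProd p (X * a * p) = entireTerm p w a X n := by
  rw [mul_assoc, pochQuot_mul_thetaProd hp h0 ha hX h, thetaCoeff, entireTerm, tri_neg]
  ring

theorem thetaProd_ne_zero_of_forall (hp : ‖p‖ < 1) (h0 : p ≠ 0) (ha : a ≠ 0) (hX : X ≠ 0)
    (h : ∀ n : ℤ, X * a * p ^ n ≠ 1) : thetaProd p (X * a * p) ≠ 0 := by
  refine thetaProd_ne_zero hp h0 (mul_ne_zero_of_forall hX ha h0) fun n hn => h (1 + n) ?_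
  rw [← hn, zpow_add₀ h0, zpow_one]; ring

theorem summable_term (hp : ‖p‖ < 1) (h0 : p ≠ 0) (w : ℂ) (ha : a ≠ 0) (hX : X ≠ 0)
    (h : ∀ n : ℤ, X * a * p ^ n ≠ 1) :
    Summable fun n => thetaCoeff p w n * pochQuot p a X n := by
  rw [← summable_mul_right_iff (thetaProd_ne_zero_of_forall hp h0 ha hX h)]
  simp_rw [term_mul_thetaProd hp h0 ha hX h]
  exact summable_entireTerm hp h0 w a X

theorem qSeries_mul_thetaProd (hp : ‖p‖ < 1) (h0 : p ≠ 0) (ha : a ≠ 0) (hX : X ≠ 0)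
    (h : ∀ n : ℤ, X * a * p ^ n ≠ 1) :
    qSeries p w a X * thetaProd p (X * a * p) = entireSeries p w a X := by
  rw [qSeries, ← tsum_mul_right, entireSeries]
  exact tsum_congr (term_mul_thetaProd hp h0 ha hX h)

theorem pochQuot_mul_arg (h0 : p ≠ 0) (n : ℤ) : pochQuot p a (X * p) n = pochQuot p a X (n + 1) := by
  have : X * p * p * p ^ n = X * p * p ^ (n + 1) := by rw [zpow_add_one₀ h0]; ring
  rw [pochQuot, pochQuot, this]

theorem forall_mul_p (h0 : p ≠ 0) (h : ∀ n : ℤ, X * a * p ^ n ≠ 1) (n : ℤ) :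
    X * p * a * p ^ n ≠ 1 := by
  intro hn
  apply h (n + 1)
  rw [zpow_add_one₀ h0, ← hn]; ring

/-- The factor p^(n+1) raises the index of the theta coefficient by one, up to -w⁻¹, so the sum is
the original series reindexed. -/
theorem tsum_thetaCoeff_mul_zpow (h0 : p ≠ 0) (hw : w ≠ 0) :
    ∑' n : ℤ, thetaCoeff p w n * p ^ (n + 1) * pochQuot p a X (n + 1)
      = -w⁻¹ * qSeries p w a X := by
  rw [qSeries, ← (Equiv.addRight (1 : ℤ)).tsum_eq (fun n => thetaCoeff p w n * pochQuot p a X n),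
    ← tsum_mul_left]
  refine tsum_congr fun n => ?_
  simp only [Equiv.coe_addRight]
  rw [thetaCoeff_add_one h0 hw]
  field_simp

theorem summable_thetaCoeff_mul_zpow (hp : ‖p‖ < 1) (h0 : p ≠ 0) (hw : w ≠ 0) (ha : a ≠ 0)
    (hX : X ≠ 0) (h : ∀ n : ℤ, X * a * p ^ n ≠ 1) :
    Summable fun n : ℤ => thetaCoeff p w n * p ^ (n + 1) * pochQuot p a X (n + 1) := by
  have := ((Equiv.addRight (1 : ℤ)).summable_iff.2
    (summable_term hp h0 w ha hX h)).mul_left (-w⁻¹)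
  refine this.congr fun n => ?_
  simp only [Function.comp_apply, Equiv.coe_addRight]
  rw [thetaCoeff_add_one h0 hw]
  field_simp

/-- Splitting off the first factor 1 - X p^(n+1) of the numerator gives two series: its 1 gives the
series at X p, its other term the reindexed series at X. -/
theorem qSeries_contiguous_up (hp : ‖p‖ < 1) (h0 : p ≠ 0) (hw : w ≠ 0) (ha : a ≠ 0) (hX : X ≠ 0)
    (h : ∀ n : ℤ, X * a * p ^ n ≠ 1) :
    qSeries p w (a * p) X = qSeries p w a (X * p) + X / w * qSeries p w a X := by
  have key : ∀ n : ℤ, thetaCoeff p w n * pochQuot p (a * p) X n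
      = thetaCoeff p w n * pochQuot p a (X * p) n
        - X * (thetaCoeff p w n * p ^ (n + 1) * pochQuot p a X (n + 1)) := by
    intro n
    have e1 : X * p * p ^ n * p = X * p * p ^ (n + 1) := by rw [zpow_add_one₀ h0]; ring
    have e2 : X * p * p ^ n * (a * p) = X * p * p ^ (n + 1) * a := by
      rw [zpow_add_one₀ h0]; ring
    rw [pochQuot_mul_arg h0, pochQuot, poch_eq hp (X * p * p ^ n), e1, e2, pochQuot]
    rw [zpow_add_one₀ h0]
    ring
  rw [qSeries, tsum_congr key, Summable.tsum_sub
    (summable_term hp h0 w ha (mul_ne_zero hX h0) (forall_mul_p h0 h))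
    ((summable_thetaCoeff_mul_zpow hp h0 hw ha hX h).mul_left X), tsum_mul_left,
    tsum_thetaCoeff_mul_zpow h0 hw, ← qSeries]
  ring

/-- Now the first factor 1 - X a p^(n+2) of a denominator is split in the same way. -/
theorem qSeries_contiguous_down (hp : ‖p‖ < 1) (h0 : p ≠ 0) (hw : w ≠ 0) (ha : a ≠ 0)
    (hX : X ≠ 0) (h : ∀ n : ℤ, X * a * p ^ n ≠ 1) :
    qSeries p w (a * p) (X * p) = qSeries p w a (X * p) + X * p / w * a * qSeries p w a X := by
  have key : ∀ n : ℤ, thetaCoeff p w n * pochQuot p (a * p) (X * p) n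
      = thetaCoeff p w n * pochQuot p a (X * p) n
        - X * p * a * (thetaCoeff p w n * p ^ (n + 1) * pochQuot p a X (n + 1)) := by
    intro n
    have hne := poch_ne_zero_of_forall hp h0 h (n + 1)
    have e1 : X * p * p ^ (n + 1) * (a * p) = X * p * p ^ (n + 1) * a * p := by ring
    have hpe := poch_eq hp (X * p * p ^ (n + 1) * a)
    have hne2 : poch p (X * p * p ^ (n + 1) * a * p) ≠ 0 := by
      intro h0'; rw [h0', mul_zero] at hpe; exact hne hpe
    rw [pochQuot_mul_arg h0, pochQuot_mul_arg h0, pochQuot, pochQuot, e1]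
    have : poch p (X * p * p ^ (n + 1)) / poch p (X * p * p ^ (n + 1) * a * p)
        = (1 - X * p * p ^ (n + 1) * a) *
          (poch p (X * p * p ^ (n + 1)) / poch p (X * p * p ^ (n + 1) * a)) := by
      have hne3 : 1 - X * p * p ^ (n + 1) * a ≠ 0 := by
        intro h0'; rw [h0', zero_mul] at hpe; exact hne hpe
      rw [hpe, ← mul_div_assoc, mul_div_mul_left _ _ hne3]
    rw [this]
    ring
  rw [qSeries, tsum_congr key, Summable.tsum_sub
    (summable_term hp h0 w ha (mul_ne_zero hX h0) (forall_mul_p h0 h))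
    ((summable_thetaCoeff_mul_zpow hp h0 hw ha hX h).mul_left (X * p * a)), tsum_mul_left,
    tsum_thetaCoeff_mul_zpow h0 hw, ← qSeries]
  ring

end Series

/-! ### The limit of the series as X p^N tends to 0 -/

section Limit

variable {p w a X : ℂ}

theorem tendsto_pochQuot (hp : ‖p‖ < 1) (a X : ℂ) :
    Tendsto (fun N : ℕ => pochQuot p a X N) atTop (𝓝 1) := by
  have h1 : Tendsto (fun N : ℕ => X * p * p ^ (N : ℤ)) atTop (𝓝 0) := by
    simp_rw [zpow_natCast]
    simpa using (tendsto_pow_atTop_nhds_zero_of_norm_lt_one hp).const_mul (X * p)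
  have h2 : Tendsto (fun N : ℕ => X * p * p ^ (N : ℤ) * a) atTop (𝓝 0) := by
    simpa using h1.mul_const a
  have hc : Tendsto (poch p) (𝓝 0) (𝓝 1) := by
    simpa using (differentiable_poch hp).continuous.tendsto 0
  have := (hc.comp h1).div (hc.comp h2) one_ne_zero
  rw [div_one] at this
  exact this

/-- Convergence to 1 bounds the quotients with n ≥ 0; for n < 0 the form without poles in
`pochQuot_mul_thetaProd` gives geometric growth. -/
theorem norm_pochQuot_le (hp : ‖p‖ < 1) (h0 : p ≠ 0) (ha : a ≠ 0) (hX : X ≠ 0)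
    (h : ∀ n : ℤ, X * a * p ^ n ≠ 1) : ∃ B L : ℝ, 0 ≤ B ∧ 1 ≤ L ∧ ∀ n : ℤ,
      ‖pochQuot p a X n‖ ≤ B * L ^ (-n).toNat := by
  obtain ⟨B₁, hB₁⟩ := (tendsto_pochQuot hp a X).norm.bddAbove_range
  have hB₁' : ∀ N : ℕ, ‖pochQuot p a X N‖ ≤ B₁ := fun N => hB₁ ⟨N, rfl⟩
  have hB₁0 : 0 ≤ B₁ := (norm_nonneg _).trans (hB₁' 0)
  set T := ‖thetaProd p (X * a * p)‖ with hT
  have hT0 : 0 < T := norm_pos_iff.2 (thetaProd_ne_zero_of_forall hp h0 ha hX h)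
  set M := ‖X * p‖ with hM
  set A := ‖(X * a * p)⁻¹‖ with hA
  set E := Real.exp (M / (1 - ‖p‖)) * Real.exp (‖(X * a)⁻¹‖ / (1 - ‖p‖)) / T with hE
  have hE0 : 0 ≤ E := by positivity
  have hL : 1 ≤ 1 + A * (1 + M) := by
    have : 0 ≤ A * (1 + M) := by positivity
    linarith
  refine ⟨B₁ + E, 1 + A * (1 + M), by positivity, hL, fun n => ?_⟩
  obtain ⟨k, rfl | rfl⟩ := n.eq_nat_or_neg
  · have : (-(k : ℤ)).toNat = 0 := by omega
    rw [this, pow_zero, mul_one]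
    linarith [hB₁' k]
  · rw [neg_neg, Int.toNat_natCast]
    have h1 := pochQuot_mul_thetaProd hp h0 ha hX h (-k)
    have h2 := norm_tri_mul_poch_neg_natCast_le hp h0 (z := X * p) le_rfl k
    have h3 : ‖poch p ((X * a)⁻¹ * p ^ (- -(k : ℤ)))‖
        ≤ Real.exp (‖(X * a)⁻¹‖ / (1 - ‖p‖)) := by
      apply norm_poch_le hp
      rw [neg_neg, zpow_natCast, norm_mul, norm_pow]
      exact mul_le_of_le_one_right (norm_nonneg _) (pow_le_one₀ (norm_nonneg _) hp.le)
    have h4 : ‖(-(X * a * p)) ^ (-(k : ℤ))‖ = A ^ k := by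
      rw [zpow_neg, ← inv_zpow, zpow_natCast, norm_pow, inv_neg, norm_neg]
    have h5 : ‖pochQuot p a X (-k)‖ * T ≤ A ^ k * ((Real.exp (M / (1 - ‖p‖)) * (1 + M) ^ k)
        * Real.exp (‖(X * a)⁻¹‖ / (1 - ‖p‖))) := by
      rw [hT, ← norm_mul, h1, norm_mul, norm_mul, h4]
      gcongr
    rw [← le_div_iff₀ hT0] at h5
    calc ‖pochQuot p a X (-k)‖ ≤ _ := h5
      _ = E * (A * (1 + M)) ^ k := by rw [hE, mul_pow]; ring
      _ ≤ (B₁ + E) * (1 + A * (1 + M)) ^ k := by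
          gcongr
          · linarith
          · linarith

theorem norm_tri_add_one_le (hp : ‖p‖ < 1) (h0 : p ≠ 0) (n : ℤ) :
    ‖tri p (n + 1)‖ ≤ ‖p‖ ^ (n.natAbs.choose 2) := by
  obtain ⟨k, rfl | rfl⟩ := n.eq_nat_or_neg
  · rw [← Nat.cast_succ, tri_natCast h0, norm_pow, Int.natAbs_natCast]
    exact pow_le_pow_of_le_one (norm_nonneg _) hp.le (Nat.choose_le_choose 2 (Nat.le_succ k))
  · rw [← tri_neg, neg_neg, tri_natCast h0, norm_pow, Int.natAbs_neg, Int.natAbs_natCast]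

theorem norm_thetaCoeff_le (hp : ‖p‖ < 1) (h0 : p ≠ 0) (w : ℂ) (n : ℤ) :
    ‖thetaCoeff p w n‖ ≤ (‖w‖ + ‖w⁻¹‖) ^ n.natAbs * ‖p‖ ^ (n.natAbs.choose 2) := by
  rw [thetaCoeff, norm_mul]
  refine mul_le_mul (norm_zpow_le ?_ ?_ n) (norm_tri_add_one_le hp h0 n) (norm_nonneg _)
    (by positivity)
  · rw [norm_neg]; simp
  · rw [inv_neg, norm_neg]; simp

theorem pochQuot_mul_pow (h0 : p ≠ 0) (N : ℕ) (n : ℤ) :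
    pochQuot p a (X * p ^ N) n = pochQuot p a X (n + N) := by
  have : X * p ^ N * p * p ^ n = X * p * p ^ (n + N) := by
    rw [zpow_add₀ h0, zpow_natCast]; ring
  rw [pochQuot, pochQuot, this]

theorem tendsto_qSeries (hp : ‖p‖ < 1) (h0 : p ≠ 0) (ha : a ≠ 0) (hX : X ≠ 0)
    (h : ∀ n : ℤ, X * a * p ^ n ≠ 1) :
    Tendsto (fun N : ℕ => qSeries p w a (X * p ^ N)) atTop (𝓝 (∑' n : ℤ, thetaCoeff p w n)) := by
  obtain ⟨B, L, hB, hL, hbd⟩ := norm_pochQuot_le hp h0 ha hX h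
  refine tendsto_tsum_of_dominated_convergence (bound := fun n : ℤ =>
    B * (((‖w‖ + ‖w⁻¹‖) * L) ^ n.natAbs * ‖p‖ ^ (n.natAbs.choose 2)))
    ((summable_int_pow_mul_pow_choose (by positivity) (norm_pos_iff.2 h0) hp).mul_left B)
    (fun n => ?_) (Eventually.of_forall fun N n => ?_)
  · have : Tendsto (fun N : ℕ => pochQuot p a X (n + N)) atTop (𝓝 1) := by
      have h1 := tendsto_pochQuot hp a (X * p ^ n)
      refine h1.congr fun N => ?_
      have : X * p ^ n * p * p ^ (N : ℤ) = X * p * p ^ (n + N) := by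
        rw [zpow_add₀ h0]; ring
      rw [pochQuot, pochQuot, this]
    simp_rw [pochQuot_mul_pow h0]
    simpa using this.const_mul (thetaCoeff p w n)
  · rw [pochQuot_mul_pow h0, norm_mul]
    -- The bound grows only towards negative indices, so adding N ≥ 0 does not worsen it and the
    -- majorant is independent of N.
    have h1 : ‖pochQuot p a X (n + N)‖ ≤ B * L ^ n.natAbs :=
      (hbd _).trans (by gcongr; omega)
    refine (mul_le_mul (norm_thetaCoeff_le hp h0 w n) h1 (norm_nonneg _)
      (by positivity)).trans_eq ?_
    rw [mul_pow]; ring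

end Limit

/-! ### The Jacobi triple product -/

section TripleProduct

variable {p w : ℂ}

/-- The finite product `(p; p)_n`. -/
noncomputable def qFac (p : ℂ) (n : ℕ) : ℂ := ∏ j ∈ Finset.range n, (1 - p * p ^ j)

/-- The inverse of `(p; p)_n`, which is `0` for negative `n`. -/
noncomputable def qFacInv (p : ℂ) (n : ℤ) : ℂ := if n < 0 then 0 else (qFac p n.toNat)⁻¹

theorem one_sub_pow_ne_zero (hp : ‖p‖ < 1) (j : ℕ) : 1 - p * p ^ j ≠ 0 := by
  rw [sub_ne_zero, ← pow_succ']
  intro h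
  have h1 := congrArg norm h
  rw [norm_one, norm_pow] at h1
  exact (pow_lt_one₀ (norm_nonneg p) hp (Nat.succ_ne_zero j)).ne h1.symm

/-- With the value 0 at negative integers the recurrence has no boundary case: at n = 0 the factor 1
- p^n vanishes. -/
theorem qFacInv_sub_one (hp : ‖p‖ < 1) (n : ℤ) :
    qFacInv p (n - 1) = (1 - p ^ n) * qFacInv p n := by
  rcases lt_trichotomy n 0 with h | rfl | h
  · rw [qFacInv, qFacInv, if_pos h, if_pos (by omega), mul_zero]
  · simp [qFacInv]
  · obtain ⟨k, rfl⟩ : ∃ k : ℕ, n = (k + 1 : ℕ) := ⟨n.toNat - 1, by omega⟩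
    have h1 : ((k + 1 : ℕ) : ℤ) - 1 = k := by push_cast; ring
    rw [h1, qFacInv, qFacInv, if_neg (by omega), if_neg (by omega), Int.toNat_natCast,
      Int.toNat_natCast, qFac, qFac, Finset.prod_range_succ, zpow_natCast, pow_succ']
    have := one_sub_pow_ne_zero hp k
    rw [mul_inv, mul_left_comm, mul_inv_cancel₀ this, mul_one]

/-- The finite form of the Jacobi triple product identity. -/
theorem hasSum_finite_tripleProduct (hp : ‖p‖ < 1) (h0 : p ≠ 0) (hw : w ≠ 0) (N : ℕ) :
    HasSum (fun k : ℤ => qFac p (2 * N) * qFacInv p (N - k) * qFacInv p (N + k) *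
        (tri p k * (-w) ^ k))
      (∏ j ∈ Finset.range N, ((1 - w * p ^ j) * (1 - p / w * p ^ j))) := by
  induction N with
  | zero =>
    have : (fun k : ℤ => qFac p (2 * 0) * qFacInv p ((0 : ℕ) - k) * qFacInv p ((0 : ℕ) + k) *
        (tri p k * (-w) ^ k)) = fun k : ℤ => if k = 0 then 1 else 0 := by
      funext k
      rcases lt_trichotomy k 0 with h | rfl | h
      · simp [qFacInv, h, h.ne]
      · simp [qFacInv, qFac]
      · simp [qFacInv, h, h.ne']
    rw [this]
    simpa using hasSum_ite_eq (0 : ℤ) (1 : ℂ)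
  | succ N ih =>
    -- The new factor (1 - w p^N)(1 - p^(N+1)/w) has three terms: one constant in w, one in w and
    -- one in w⁻¹. The last two shift the summation index by ∓1, and the coefficients recombine to
    -- those of size N + 1.
    have h1 := ih.mul_left (1 + p * (p ^ N * p ^ N))
    have h2 := ((Equiv.subRight (1 : ℤ)).hasSum_iff.2 ih).mul_left (-w * p ^ N)
    have h3 := ((Equiv.addRight (1 : ℤ)).hasSum_iff.2 ih).mul_left (-w⁻¹ * p * p ^ N)
    have h4 := (h1.add h2).add h3
    rw [Finset.prod_range_succ]
    generalize ∏ j ∈ Finset.range N, ((1 - w * p ^ j) * (1 - p / w * p ^ j)) = F at *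
    have hF : F * ((1 - w * p ^ N) * (1 - p / w * p ^ N)) =
        (1 + p * (p ^ N * p ^ N)) * F + -w * p ^ N * F + -w⁻¹ * p * p ^ N * F := by
      field_simp
      ring
    rw [hF]
    refine h4.congr_fun fun k => ?_
    · simp only [Function.comp_apply, Equiv.subRight_apply, Equiv.coe_addRight]
      have hP : p ^ k ≠ 0 := zpow_ne_zero k h0
      have e1 : qFacInv p (N - k) = (1 - p * p ^ N * (p ^ k)⁻¹) * qFacInv p ((N + 1 : ℕ) - k) := by
        have := qFacInv_sub_one hp ((N + 1 : ℕ) - k)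
        rw [zpow_sub₀ h0, zpow_natCast, pow_succ', div_eq_mul_inv] at this
        rw [← this]; congr 1; push_cast; ring
      have e2 : qFacInv p (N + k) = (1 - p * p ^ N * p ^ k) * qFacInv p ((N + 1 : ℕ) + k) := by
        have := qFacInv_sub_one hp ((N + 1 : ℕ) + k)
        rw [zpow_add₀ h0, zpow_natCast, pow_succ'] at this
        rw [← this]; congr 1; push_cast; ring
      have e3 : qFacInv p (N - (k - 1)) = qFacInv p ((N + 1 : ℕ) - k) := by
        congr 1; push_cast; ring
      have e4 : qFacInv p (N + (k - 1)) = (1 - p ^ N * p ^ k) * qFacInv p (N + k) := by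
        have := qFacInv_sub_one hp (N + k)
        rw [zpow_add₀ h0, zpow_natCast] at this
        rw [← this]; congr 1; ring
      have e5 : qFacInv p (N + (k + 1)) = qFacInv p ((N + 1 : ℕ) + k) := by
        congr 1; push_cast; ring
      have e6 : qFacInv p (N - (k + 1)) = (1 - p ^ N * (p ^ k)⁻¹) * qFacInv p (N - k) := by
        have := qFacInv_sub_one hp (N - k)
        rw [zpow_sub₀ h0, zpow_natCast, div_eq_mul_inv] at this
        rw [← this]; congr 1; ring
      have e7 : qFac p (2 * (N + 1))
          = qFac p (2 * N) * (1 - p * (p ^ N * p ^ N)) * (1 - p * (p * (p ^ N * p ^ N))) := by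
        rw [mul_add, mul_one, qFac, Finset.prod_range_succ, Finset.prod_range_succ, qFac]
        ring
      have e8 : tri p (k - 1) = tri p k * (p * (p ^ k)⁻¹) := by
        have := tri_add_one h0 (k - 1)
        rw [sub_add_cancel, zpow_sub_one₀ h0] at this
        rw [this]; field_simp
      have e9 : (-w) ^ (k - 1) = (-w) ^ k * -w⁻¹ := by
        rw [zpow_sub_one₀ (neg_ne_zero.2 hw), inv_neg]
      have e10 : (-w) ^ (k + 1) = (-w) ^ k * -w := zpow_add_one₀ (neg_ne_zero.2 hw) k
      rw [e3, e4, e5, e6, e1, e2, e7, e8, e9, e10, tri_add_one h0]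
      field_simp
      ring

theorem tendsto_qFac (hp : ‖p‖ < 1) : Tendsto (qFac p) atTop (𝓝 (poch p p)) :=
  (multipliable_poch hp p).tendsto_prod_tprod_nat

theorem poch_self_ne_zero (hp : ‖p‖ < 1) : poch p p ≠ 0 :=
  poch_ne_zero hp fun j h => one_sub_pow_ne_zero hp j (sub_eq_zero.2 h.symm)

theorem tendsto_qFacInv (hp : ‖p‖ < 1) : Tendsto (qFacInv p) atTop (𝓝 (poch p p)⁻¹) := by
  have h1 := (tendsto_qFac hp).inv₀ (poch_self_ne_zero hp)
  have h2 : Tendsto Int.toNat atTop atTop :=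
    tendsto_atTop_atTop.2 fun b => ⟨b, fun a h => by omega⟩
  refine (h1.comp h2).congr' ?_
  filter_upwards [eventually_ge_atTop 0] with n hn
  rw [qFacInv, if_neg (by omega)]
  rfl

theorem norm_qFacInv_le (hp : ‖p‖ < 1) : ∃ B : ℝ, ∀ n : ℤ, ‖qFacInv p n‖ ≤ B := by
  obtain ⟨B, hB⟩ := ((tendsto_qFac hp).inv₀ (poch_self_ne_zero hp)).norm.bddAbove_range
  refine ⟨B, fun n => ?_⟩
  have h : ∀ k : ℕ, ‖(qFac p k)⁻¹‖ ≤ B := fun k => hB ⟨k, rfl⟩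
  rw [qFacInv]
  split_ifs
  · simpa using (norm_nonneg _).trans (h 0)
  · exact h _

theorem norm_tri_le (hp : ‖p‖ < 1) (h0 : p ≠ 0) (n : ℤ) :
    ‖tri p n‖ ≤ ‖p‖ ^ (n.natAbs.choose 2) := by
  have := norm_tri_add_one_le hp h0 (-n)
  rwa [← tri_neg, neg_neg, Int.natAbs_neg] at this

/-- The Jacobi triple product identity. -/
theorem tsum_tri_mul_zpow (hp : ‖p‖ < 1) (h0 : p ≠ 0) (hw : w ≠ 0) :
    ∑' k : ℤ, tri p k * (-w) ^ k = poch p p * thetaProd p w := by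
  obtain ⟨B, hB⟩ := norm_qFacInv_le hp
  obtain ⟨D, hD⟩ := (tendsto_qFac hp).norm.bddAbove_range
  have hD' : ∀ k : ℕ, ‖qFac p k‖ ≤ D := fun k => hD ⟨k, rfl⟩
  have hB0 : 0 ≤ B := (norm_nonneg _).trans (hB 0)
  have hD0 : 0 ≤ D := (norm_nonneg _).trans (hD' 0)
  -- The Gaussian binomial coefficients tend to 1/(p; p)_∞ and are bounded uniformly, so N → ∞ in
  -- the finite identity is justified by dominated convergence.
  have h1 : Tendsto (fun N : ℕ => ∑' k : ℤ, qFac p (2 * N) * qFacInv p (N - k) *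
      qFacInv p (N + k) * (tri p k * (-w) ^ k)) atTop
      (𝓝 (∑' k : ℤ, (poch p p)⁻¹ * (tri p k * (-w) ^ k))) := by
    refine tendsto_tsum_of_dominated_convergence (bound := fun k : ℤ =>
      D * B * B * ((‖w‖ + ‖w⁻¹‖) ^ k.natAbs * ‖p‖ ^ (k.natAbs.choose 2)))
      ((summable_int_pow_mul_pow_choose (by positivity) (norm_pos_iff.2 h0) hp).mul_left _)
      (fun k => ?_) (Eventually.of_forall fun N k => ?_)
    · have t1 : Tendsto (fun N : ℕ => qFac p (2 * N)) atTop (𝓝 (poch p p)) :=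
        (tendsto_qFac hp).comp (tendsto_id.const_mul_atTop' two_pos)
      have t2 : Tendsto (fun N : ℕ => qFacInv p (N - k)) atTop (𝓝 (poch p p)⁻¹) :=
        (tendsto_qFacInv hp).comp
          (tendsto_atTop_add_const_right _ (-k) tendsto_natCast_atTop_atTop)
      have t3 : Tendsto (fun N : ℕ => qFacInv p (N + k)) atTop (𝓝 (poch p p)⁻¹) :=
        (tendsto_qFacInv hp).comp
          (tendsto_atTop_add_const_right _ k tendsto_natCast_atTop_atTop)
      have := ((t1.mul t2).mul t3).mul_const (tri p k * (-w) ^ k)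
      rwa [mul_inv_cancel₀ (poch_self_ne_zero hp), one_mul] at this
    · rw [norm_mul, norm_mul, norm_mul, norm_mul]
      have h2 : ‖(-w) ^ k‖ ≤ (‖w‖ + ‖w⁻¹‖) ^ k.natAbs :=
        norm_zpow_le (by rw [norm_neg]; exact le_add_of_nonneg_right (norm_nonneg _))
          (by rw [inv_neg, norm_neg]; exact le_add_of_nonneg_left (norm_nonneg _)) k
      rw [mul_comm ((‖w‖ + ‖w⁻¹‖) ^ k.natAbs)]
      gcongr
      · exact hD' _
      · exact hB _
      · exact hB _
      · exact norm_tri_le hp h0 k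
  have h2 : Tendsto (fun N : ℕ => ∏ j ∈ Finset.range N, ((1 - w * p ^ j) * (1 - p / w * p ^ j)))
      atTop (𝓝 (thetaProd p w)) := by
    simp_rw [Finset.prod_mul_distrib]
    exact (multipliable_poch hp w).tendsto_prod_tprod_nat.mul
      (multipliable_poch hp (p / w)).tendsto_prod_tprod_nat
  simp_rw [(hasSum_finite_tripleProduct hp h0 hw _).tsum_eq] at h1
  have h3 := tendsto_nhds_unique h2 h1
  rw [h3, tsum_mul_left, mul_inv_cancel_left₀ (poch_self_ne_zero hp)]

theorem tsum_thetaCoeff_ne_zero (hp : ‖p‖ < 1) (h0 : p ≠ 0) (hw : w ≠ 0)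
    (h : ∀ n : ℤ, w * p ^ n ≠ 1) : ∑' n : ℤ, thetaCoeff p w n ≠ 0 := by
  have h1 : ∑' k : ℤ, tri p k * (-w) ^ k = -w * ∑' n : ℤ, thetaCoeff p w n := by
    rw [← (Equiv.addRight (1 : ℤ)).tsum_eq, ← tsum_mul_left]
    refine tsum_congr fun n => ?_
    simp only [Equiv.coe_addRight]
    rw [thetaCoeff, zpow_add_one₀ (neg_ne_zero.2 hw)]
    ring
  intro h2
  rw [h2, mul_zero, tsum_tri_mul_zpow hp h0 hw] at h1
  exact mul_ne_zero (poch_self_ne_zero hp) (thetaProd_ne_zero hp h0 hw h) h1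

end TripleProduct

/-! ### The contiguous sequences -/

section Sequence

variable {p w Q X : ℂ}

/-- The sequence of the series `qSeries` with parameters `Q`, `Q p`, `Q p ^ 2`, .... -/
noncomputable def qSeq (p w Q X : ℂ) : ℕ → ℂ := fun N => qSeries p w (Q * p ^ N) X

theorem sh_qSeq (p w Q X : ℂ) : sh (qSeq p w Q X) = qSeq p w (Q * p) X := by
  funext N
  simp only [sh, qSeq, pow_succ']
  ring_nf

theorem forall_mul_pow (h0 : p ≠ 0) (h : ∀ n : ℤ, X * Q * p ^ n ≠ 1) (N : ℕ) (n : ℤ) :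
    X * (Q * p ^ N) * p ^ n ≠ 1 := by
  intro hn
  apply h (N + n)
  rw [zpow_add₀ h0, zpow_natCast, ← hn]
  ring

theorem contiguous_qSeq (hp : ‖p‖ < 1) (h0 : p ≠ 0) (hw : w ≠ 0) (hQ : Q ≠ 0) (hX : X ≠ 0)
    (h : ∀ n : ℤ, X * Q * p ^ n ≠ 1) :
    Contiguous p Q (X * p / w) (qSeq p w Q X) (qSeq p w Q (X * p)) (qSeq p w Q (X * p * p)) := by
  have hQN : ∀ N : ℕ, Q * p ^ N ≠ 0 := fun N => mul_ne_zero hQ (pow_ne_zero N h0)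
  have hs : ∀ N : ℕ, Q * p ^ (N + 1) = Q * p ^ N * p := fun N => by ring
  have hup : ∀ Y : ℂ, Y ≠ 0 → (∀ n : ℤ, Y * Q * p ^ n ≠ 1) →
      chr 1 (qSeq p w Q (Y * p)) = fun N => Y * p / w * Q * p ^ N * qSeq p w Q Y N := by
    intro Y hY hYn
    funext N
    simp only [chr, qSeq, hs]
    rw [qSeries_contiguous_down hp h0 hw (hQN N) hY (forall_mul_pow h0 hYn N)]
    ring
  have hup₁ : chr (X * p / w) (qSeq p w Q (X * p)) = qSeq p w Q (X * p * p) := by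
    funext N
    simp only [chr, qSeq, hs]
    rw [qSeries_contiguous_up hp h0 hw (hQN N) (mul_ne_zero hX h0)
      (forall_mul_pow h0 (forall_mul_p h0 h) N)]
    ring
  refine ⟨hup X hX h, hup₁, ?_⟩
  -- The composite relation is the downward one, taken one step further at X p.
  rw [hup₁, hup (X * p) (mul_ne_zero hX h0) (forall_mul_p h0 h)]
  funext N
  ring

end Sequence

/-! ### Passage from μ and ξ to the series and tau functions -/

section Exponential

open Complex

/-- The function `z ↦ exp (2 π i z)`. -/
noncomputable def ee (z : ℂ) : ℂ := exp (2 * Real.pi * I * z)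

theorem ee_ne_zero (z : ℂ) : ee z ≠ 0 := exp_ne_zero _

theorem ee_add (y z : ℂ) : ee (y + z) = ee y * ee z := by
  rw [ee, ee, ee, ← exp_add]; congr 1; ring

theorem ee_neg (z : ℂ) : ee (-z) = (ee z)⁻¹ := by
  rw [ee, ee, ← exp_neg]; congr 1; ring

theorem ee_sub (y z : ℂ) : ee (y - z) = ee y / ee z := by
  rw [sub_eq_add_neg, ee_add, ee_neg, div_eq_mul_inv]

theorem ee_int_mul (n : ℤ) (z : ℂ) : ee (n * z) = ee z ^ n := by
  rw [ee, ee, ← exp_int_mul]; congr 1; ring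

theorem ee_nat_mul (n : ℕ) (z : ℂ) : ee (n * z) = ee z ^ n := by
  rw [ee, ee, ← exp_nat_mul]; congr 1; ring

theorem ee_eq_one_iff {z : ℂ} : ee z = 1 ↔ ∃ n : ℤ, z = n := by
  have h : (2 * Real.pi * I : ℂ) ≠ 0 := two_pi_I_ne_zero
  rw [ee, exp_eq_one_iff]
  refine exists_congr fun n => ?_
  rw [mul_comm]
  exact mul_left_inj' h

theorem norm_ee_lt_one {τ : ℂ} (hτ : 0 < τ.im) : ‖ee τ‖ < 1 := by
  rw [ee, norm_exp, Real.exp_lt_one_iff]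
  have : (2 * Real.pi * I * τ).re = -(2 * Real.pi * τ.im) := by
    simp
  rw [this]
  have := Real.pi_pos
  rw [neg_lt_zero]
  positivity

theorem ee_mul_zpow_ne_one {τ z : ℂ} (hz : z ∉ lattice τ) (n : ℤ) : ee z * ee τ ^ n ≠ 1 := by
  rw [← ee_int_mul, ← ee_add, Ne, ee_eq_one_iff]
  rintro ⟨k, hk⟩
  exact hz ⟨-n, k, by rw [← hk]; push_cast; ring⟩

theorem notMem_lattice_iff {τ z : ℂ} : z ∉ lattice τ ↔ ∀ n : ℤ, ee z * ee τ ^ n ≠ 1 := by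
  refine ⟨ee_mul_zpow_ne_one, fun h => ?_⟩
  rintro ⟨a, b, rfl⟩
  apply h (-a)
  rw [← ee_int_mul, ← ee_add, ee_eq_one_iff]
  exact ⟨b, by push_cast; ring⟩

theorem tri_ee_add_one (τ : ℂ) (n : ℤ) :
    tri (ee τ) (n + 1) = exp (Real.pi * I * n * (n + 1) * τ) := by
  obtain ⟨k, hk⟩ : ∃ k : ℤ, (n + 1) * (n + 1 - 1) = 2 * k := by
    obtain ⟨k, hk⟩ := Int.even_mul_succ_self n
    exact ⟨k, by linarith⟩
  rw [tri, hk, Int.mul_ediv_cancel_left k two_ne_zero, ← ee_int_mul, ee]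
  congr 1
  have : ((n : ℂ) + 1) * n = 2 * k := by
    have := congrArg (Int.cast : ℤ → ℂ) hk
    push_cast at this
    rw [← this]; ring
  linear_combination -(Real.pi * I * τ) * this

theorem neg_ee_zpow (v : ℂ) (n : ℤ) : (-ee v) ^ n = ee (n * (v + 1 / 2)) := by
  have h : ee (v + 1 / 2) = -ee v := by
    rw [ee_add]
    have : ee (1 / 2) = -1 := by
      rw [ee, ← exp_pi_mul_I]; congr 1; ring
    rw [this]; ring
  rw [ee_int_mul, h]

theorem theta_eq (τ v : ℂ) : theta τ v =
    exp (Real.pi * I * (v + 1 / 2) + Real.pi * I / 4 * τ) *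
      ∑' n : ℤ, thetaCoeff (ee τ) (ee v) n := by
  rw [theta, ← tsum_mul_left]
  refine tsum_congr fun n => ?_
  rw [thetaCoeff, tri_ee_add_one, neg_ee_zpow, ee, ← exp_add, ← exp_add]
  congr 1
  ring

theorem theta_ne_zero {τ v : ℂ} (hτ : 0 < τ.im) (hv : v ∉ lattice τ) : theta τ v ≠ 0 := by
  rw [theta_eq]
  exact mul_ne_zero (exp_ne_zero _) (tsum_thetaCoeff_ne_zero (norm_ee_lt_one hτ) (ee_ne_zero τ)
    (ee_ne_zero v) (ee_mul_zpow_ne_one hv))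

theorem tprod_div_eq_pochQuot {p a X : ℂ} (hp : ‖p‖ < 1) (h0 : p ≠ 0)
    (h : ∀ n : ℤ, X * a * p ^ n ≠ 1) (n : ℤ) :
    ∏' j : ℕ, (1 - X * p * p ^ n * p ^ j) / (1 - X * p * p ^ n * a * p ^ j) = pochQuot p a X n :=
  Multipliable.tprod_div₀ (L := .unconditional ℕ) (multipliable_poch hp _)
    (multipliable_poch hp _) (poch_ne_zero_of_forall hp h0 h n)

theorem mu_eq {τ u v α : ℂ} (hτ : 0 < τ.im) (h : u - α * τ ∉ lattice τ) :
    mu τ u v α = exp (Real.pi * I * α * (u - v)) / theta τ v *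
      (exp (Real.pi * I * v) * qSeries (ee τ) (ee v) (ee (-(α * τ))) (ee u)) := by
  rw [mu, qSeries]
  congr 1
  rw [← tsum_mul_left]
  refine tsum_congr fun n => ?_
  have hn : ∀ n : ℤ, ee u * ee (-(α * τ)) * ee τ ^ n ≠ 1 := by
    rw [← ee_add, ← sub_eq_add_neg]
    exact ee_mul_zpow_ne_one h
  have hexp : exp (2 * Real.pi * I * ((n : ℂ) + 1 / 2) * v)
      = exp (Real.pi * I * v) * ee v ^ n := by
    rw [← ee_int_mul, ee, ← exp_add]; congr 1; ring
  rw [← tprod_div_eq_pochQuot (norm_ee_lt_one hτ) (ee_ne_zero τ) hn, ← mul_assoc, thetaCoeff,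
    tri_ee_add_one, neg_eq_neg_one_mul (ee v), mul_zpow, hexp]
  congr 1
  · ring
  · refine tprod_congr fun j => ?_
    rw [mul_right_comm _ (ee _) (ee τ ^ j), ← ee_int_mul, ← ee_nat_mul, ← ee_add, ← ee_add,
      ← ee_add, ← ee_add, ee, ee]
    congr 3 <;> ring_nf

/-- The sequence whose Hankel determinants are the tau functions. -/
noncomputable def tauSeq (τ v m u : ℂ) : ℕ → ℂ := qSeq (ee τ) (ee v) (ee (-(m * τ))) (ee (u + v))

/-- The tau function of size `k` in the variable `u`. -/
noncomputable def tau (τ v m u : ℂ) (k : ℕ) : ℂ := hank k (tauSeq τ v m u)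

theorem sh_tauSeq (τ v m u : ℂ) : sh (tauSeq τ v m u) = tauSeq τ v (m - 1) u := by
  rw [tauSeq, sh_qSeq, ← ee_add, tauSeq]; ring_nf

/-- The factor relating `ξ` to the tau function. -/
noncomputable def xiFactor (τ v m u : ℂ) (k : ℕ) : ℂ :=
  (exp (Real.pi * I * m * u) * exp (Real.pi * I * v) / theta τ v) ^ k *
    gauge (exp (-(Real.pi * I * u))) k

theorem sub_int_mul_notMem_lattice {τ z : ℂ} (h : z ∉ lattice τ) (k : ℤ) :
    z + k * τ ∉ lattice τ := by
  rintro ⟨a, b, hab⟩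
  exact h ⟨a - k, b, by push_cast; linear_combination hab⟩

/-- The exponential prefactor of the entry (i, j) is geometric in i + j. One pole condition serves
all entries, because the lattice is invariant under integer multiples of τ. -/
theorem xi_eq {τ v m u κ : ℂ} {n : ℤ} {k : ℕ} (hτ : 0 < τ.im) (hn : n + 1 = k)
    (h : u + κ * τ + v - m * τ ∉ lattice τ) :
    xi τ v u m n κ = xiFactor τ v m (u + κ * τ) k * tau τ v m (u + κ * τ) k := by
  have hk : (n + 1).toNat = k := by omega
  rw [xi, hk, tau, tauSeq, xiFactor, ← hank_geom, hank]
  congr 2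
  ext i j
  rw [mu_eq hτ]
  · have e1 : ee (-((m - (i : ℕ) - (j : ℕ)) * τ)) = ee (-(m * τ)) * ee τ ^ ((i : ℕ) + (j : ℕ)) := by
      rw [← ee_nat_mul, ← ee_add]; congr 1; push_cast; ring
    have e2 : exp (Real.pi * I * (m - (i : ℕ) - (j : ℕ)) * (u + v + κ * τ - v))
        = exp (Real.pi * I * m * (u + κ * τ)) *
          exp (-(Real.pi * I * (u + κ * τ))) ^ ((i : ℕ) + (j : ℕ)) := by
      rw [← exp_nat_mul, ← exp_add]; congr 1; push_cast; ring
    rw [e1, e2, qSeq, show u + v + κ * τ = u + κ * τ + v by ring]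
    ring_nf
  · have := sub_int_mul_notMem_lattice h ((i : ℕ) + (j : ℕ))
    convert this using 2
    push_cast; ring

end Exponential

/-! ### Row operations by monic polynomials in the shift -/

section RowOperations

open Polynomial

variable {K : Type*} [Field K]

/-- The operators `chr (c 0)`, …, `chr (c (i - 1))` applied successively. -/
def iterChr (c : ℕ → K) : ℕ → (ℕ → K) → ℕ → K
  | 0, h => h
  | i + 1, h => chr (c i) (iterChr c i h)

/-- The shift of sequences as a linear endomorphism. -/
def shiftEnd (K : Type*) [Field K] : Module.End K (ℕ → K) where
  toFun := sh
  map_add' _ _ := rfl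
  map_smul' _ _ := rfl

theorem shiftEnd_pow_apply (l : ℕ) (h : ℕ → K) (N : ℕ) : (shiftEnd K ^ l) h N = h (l + N) := by
  induction l generalizing h with
  | zero => simp
  | succ l ih =>
    rw [pow_succ, Module.End.mul_apply, ih]
    change h (l + N + 1) = _
    congr 1
    ring

theorem iterChr_eq_aeval (c : ℕ → K) (i : ℕ) (h : ℕ → K) :
    iterChr c i h = aeval (shiftEnd K) (∏ l ∈ Finset.range i, (X - C (c l))) h := by
  induction i with
  | zero => simp [iterChr]
  | succ i ih =>
    rw [Finset.prod_range_succ, mul_comm, map_mul, Module.End.mul_apply, ← ih, map_sub, aeval_X,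
      aeval_C]
    rfl

/-- The i-th new row is a monic polynomial of degree i in E applied to the first row, so the matrix
of row operations has determinant 1. -/
theorem hank_eq_det_iterChr (c : ℕ → K) (n : ℕ) (h : ℕ → K) :
    hank n h = Matrix.det (Matrix.of fun i j : Fin n => iterChr c i h j) := by
  set P : Fin n → K[X] := fun i => ∏ l ∈ Finset.range i, (X - C (c l)) with hP
  have hdeg : ∀ i, (P i).natDegree = i := fun i => by
    rw [hP, natDegree_finsetProd_X_sub_C_eq_card, Finset.card_range]
  have hdet := Matrix.det_matrixOfPolynomials P hdeg fun i => monic_prod_X_sub_C _ _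
  rw [← Matrix.det_transpose] at hdet
  rw [hank, ← one_mul (Matrix.det _), ← hdet, ← Matrix.det_mul]
  congr 1
  ext i j
  rw [Matrix.of_apply, iterChr_eq_aeval, aeval_eq_sum_range' (n := n)
    ((hdeg i).trans_lt i.2), Matrix.mul_apply, LinearMap.sum_apply, Finset.sum_apply,
    ← Fin.sum_univ_eq_sum_range (fun l => ((P i).coeff l • shiftEnd K ^ l) h j)]
  refine Finset.sum_congr rfl fun l _ => ?_
  rw [LinearMap.smul_apply, Pi.smul_apply, shiftEnd_pow_apply]
  rfl

end RowOperations

/-! ### Non-vanishing of the Hankel determinants at some point -/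

section NonVanishing

variable {p w Q X : ℂ}

theorem forall_mul_zpow (h0 : p ≠ 0) (h : ∀ n : ℤ, X * Q * p ^ n ≠ 1) (k n : ℤ) :
    X * p ^ k * Q * p ^ n ≠ 1 := by
  intro hn
  apply h (k + n)
  rw [zpow_add₀ h0, ← hn]
  ring

/-- On a sequence (p^i)^N g(N) the operator E - p^i acts as E - 1 on g, up to the factor p^i. So
each step applies the downward relation once more, and its factor p^N raises i by one. -/
theorem iterChr_qSeq (hp : ‖p‖ < 1) (h0 : p ≠ 0) (hw : w ≠ 0) (hQ : Q ≠ 0) (hX : X ≠ 0)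
    (h : ∀ n : ℤ, X * Q * p ^ n ≠ 1) (i : ℕ) :
    ∃ c : ℂ, c ≠ 0 ∧ iterChr (fun l => p ^ l) i (qSeq p w Q X)
      = fun N => c * (p ^ i) ^ N * qSeq p w Q (X * p ^ (-i : ℤ)) N := by
  induction i with
  | zero => exact ⟨1, one_ne_zero, by simp [iterChr]⟩
  | succ i ih =>
    obtain ⟨c, hc, hi⟩ := ih
    set Y := X * p ^ (-(i + 1 : ℕ) : ℤ) with hY
    have hY0 : Y ≠ 0 := mul_ne_zero hX (zpow_ne_zero _ h0)
    have hYp : X * p ^ (-i : ℤ) = Y * p := by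
      rw [hY, mul_assoc, ← zpow_add_one₀ h0]; congr 2; push_cast; ring
    have hdown := (contiguous_qSeq hp h0 hw hQ hY0 (forall_mul_zpow h0 h _)).down
    refine ⟨c * p ^ i * (Y * p / w * Q), ?_, ?_⟩
    · simp [hc, h0, hY0, hw, hQ]
    · rw [iterChr, hi, hYp]
      funext N
      have := congrFun hdown N
      simp only [chr] at this ⊢
      linear_combination (c * p ^ i * (p ^ i) ^ N) * this

theorem det_mul_pow_ne_zero (hp : ‖p‖ < 1) (h0 : p ≠ 0) {c : ℂ} (hc : c ≠ 0) (n : ℕ) :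
    Matrix.det (Matrix.of fun i j : Fin n => (p ^ (i : ℕ)) ^ (j : ℕ) * c) ≠ 0 := by
  have h1 : (Matrix.of fun i j : Fin n => (p ^ (i : ℕ)) ^ (j : ℕ) * c)
      = c • Matrix.vandermonde fun i : Fin n => p ^ (i : ℕ) := by
    ext i j
    rw [Matrix.smul_apply, Matrix.vandermonde_apply, smul_eq_mul, mul_comm, Matrix.of_apply]
  rw [h1, Matrix.det_smul]
  refine mul_ne_zero (pow_ne_zero _ hc) (Matrix.det_vandermonde_ne_zero_iff.2 fun i j hij => ?_)
  have h2 := congrArg norm hij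
  simp only [norm_pow] at h2
  exact Fin.ext ((pow_right_strictAnti₀ (norm_pos_iff.2 h0) hp).injective h2)

theorem exists_hank_qSeq_ne_zero (hp : ‖p‖ < 1) (h0 : p ≠ 0) (hw : w ≠ 0) (hQ : Q ≠ 0)
    (hX : X ≠ 0) (h : ∀ n : ℤ, X * Q * p ^ n ≠ 1) (hwn : ∀ n : ℤ, w * p ^ n ≠ 1) (n : ℕ) :
    ∃ M : ℕ, hank n (qSeq p w Q (X * p ^ M)) ≠ 0 := by
  set D : ℕ → Matrix (Fin n) (Fin n) ℂ := fun M => Matrix.of fun i j : Fin n =>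
    (p ^ (i : ℕ)) ^ (j : ℕ) * qSeq p w Q (X * p ^ (-(i : ℕ) : ℤ) * p ^ M) j with hD
  -- The limit of every series is the same theta series, so only the Vandermonde factors depend on
  -- the entry.
  have hlim : Tendsto (fun M => (D M).det) atTop (𝓝 (Matrix.det (Matrix.of fun i j : Fin n =>
      (p ^ (i : ℕ)) ^ (j : ℕ) * ∑' k : ℤ, thetaCoeff p w k))) := by
    refine ((continuous_id.matrix_det).tendsto _).comp (tendsto_pi_nhds.2 fun i =>
      tendsto_pi_nhds.2 fun j => ?_)
    exact (tendsto_qSeries hp h0 (mul_ne_zero hQ (pow_ne_zero _ h0))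
      (mul_ne_zero hX (zpow_ne_zero _ h0))
      (forall_mul_pow h0 (forall_mul_zpow h0 h _) _)).const_mul _
  obtain ⟨M, hM⟩ := (hlim.eventually_ne
    (det_mul_pow_ne_zero hp h0 (tsum_thetaCoeff_ne_zero hp h0 hw hwn) n)).exists
  refine ⟨M, ?_⟩
  have hXM : X * p ^ M ≠ 0 := mul_ne_zero hX (pow_ne_zero M h0)
  have hM' : ∀ k : ℤ, X * p ^ M * Q * p ^ k ≠ 1 := by
    have := forall_mul_zpow h0 h M
    simpa only [zpow_natCast] using this
  choose c hc hiter using iterChr_qSeq hp h0 hw hQ hXM hM'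
  have hmat : (Matrix.of fun i j : Fin n => iterChr (fun l => p ^ l) i (qSeq p w Q (X * p ^ M)) j)
      = Matrix.of fun i j : Fin n => c i * D M i j := by
    ext i j
    simp only [Matrix.of_apply, hiter, hD]
    rw [mul_right_comm X, mul_assoc]
  rw [hank_eq_det_iterChr (fun l => p ^ l), hmat, Matrix.det_mul_column]
  exact mul_ne_zero (Finset.prod_ne_zero_iff.2 fun i _ => hc i) hM

end NonVanishing

/-! ### Regularity outside a closed discrete set -/

section Codiscrete

theorem thetaProd_eq_zero {p z : ℂ} (hp : ‖p‖ < 1) (h0 : p ≠ 0) (hz : z ≠ 0) {n : ℤ}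
    (h : z * p ^ n = 1) : thetaProd p z = 0 := by
  rw [← thetaProd_mul_zpow hp h0 hz n, h, thetaProd, poch_eq hp 1]
  simp

/-- The Hankel determinants of `qSeq`, multiplied by a power of a theta function which cancels
their poles. -/
noncomputable def entireTau (p w Q X : ℂ) (k : ℕ) : ℂ :=
  hank k fun N => entireSeries p w (Q * p ^ N) X * (tri p N * (-(X * Q * p)) ^ N)

/-- The theta functions clearing the poles of the individual terms of the sequence differ by
quasi-periodicity factors; with these included, the same theta factor comes out of every entry. -/
theorem entireTau_eq {p w Q X : ℂ} (hp : ‖p‖ < 1) (h0 : p ≠ 0) (hQ : Q ≠ 0)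
    (hX : X ≠ 0) (h : ∀ n : ℤ, X * Q * p ^ n ≠ 1) (k : ℕ) :
    entireTau p w Q X k = thetaProd p (X * Q * p) ^ k * hank k (qSeq p w Q X) := by
  have h1 := hank_geom k (thetaProd p (X * Q * p)) 1 (qSeq p w Q X)
  have h2 : gauge (1 : ℂ) k = 1 := by simp [gauge]
  rw [h2, mul_one] at h1
  rw [← h1, entireTau]
  congr 1
  funext N
  have hz := mul_ne_zero_of_forall hX hQ h0
  rw [← qSeries_mul_thetaProd hp h0 (mul_ne_zero hQ (pow_ne_zero N h0)) hX (forall_mul_pow h0 h N),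
    ← thetaProd_mul_zpow hp h0 hz N, qSeq, zpow_natCast, zpow_natCast,
    show X * (Q * p ^ N) * p = X * Q * p * p ^ N by ring]
  ring

theorem differentiable_ee : Differentiable ℂ ee := by
  unfold ee; fun_prop

theorem differentiable_entireTau {p w Q : ℂ} (hp : ‖p‖ < 1) (h0 : p ≠ 0) (hQ : Q ≠ 0) (v : ℂ)
    (k : ℕ) : Differentiable ℂ fun u => entireTau p w Q (ee (u + v)) k := by
  have he : Differentiable ℂ fun u => ee (u + v) :=
    differentiable_ee.comp (differentiable_id.add_const v)
  simp only [entireTau, hank]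
  have hentry : ∀ N : ℕ, Differentiable ℂ fun u => entireSeries p w (Q * p ^ N) (ee (u + v)) *
      (tri p N * (-(ee (u + v) * Q * p)) ^ N) := by
    intro N
    refine Differentiable.mul (fun u => ?_) (by fun_prop)
    exact (differentiableAt_entireSeries hp h0 w (mul_ne_zero hQ (pow_ne_zero N h0))
      (ee_ne_zero (u + v))).comp u (he u)
  simp only [Matrix.det_apply, Matrix.of_apply]
  fun_prop

theorem differentiable_thetaProd_ee {p : ℂ} (hp : ‖p‖ < 1) {c : ℂ} (hc : c ≠ 0) (v : ℂ) :
    Differentiable ℂ fun u => thetaProd p (ee (u + v) * c) := by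
  have he : Differentiable ℂ fun u => ee (u + v) :=
    differentiable_ee.comp (differentiable_id.add_const v)
  have h1 : Differentiable ℂ fun u => ee (u + v) * c := he.mul_const c
  unfold thetaProd
  exact ((differentiable_poch hp).comp h1).mul ((differentiable_poch hp).comp
    ((differentiable_const p).div h1 fun u => mul_ne_zero (ee_ne_zero _) hc))

theorem eventually_codiscrete_ne_zero {f : ℂ → ℂ} (hf : Differentiable ℂ f) {z : ℂ}
    (hz : f z ≠ 0) : ∀ᶠ u in codiscrete ℂ, f u ≠ 0 :=
  AnalyticOnNhd.preimage_zero_mem_codiscrete (fun u _ => hf.analyticAt u) hz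

theorem eventually_tau_ne_zero {τ v : ℂ} (hτ : 0 < τ.im) (hv : v ∉ lattice τ) (m κ : ℂ) (k : ℕ) :
    ∀ᶠ u in codiscrete ℂ, u + κ + v - m * τ ∉ lattice τ ∧ tau τ v m (u + κ) k ≠ 0 := by
  have hp := norm_ee_lt_one hτ
  have h0 := ee_ne_zero τ
  have hQ := ee_ne_zero (-(m * τ))
  have hc : ee (-(m * τ)) * ee τ ≠ 0 := mul_ne_zero hQ h0
  -- At the base point u = mτ - κ the product X Q equals e^(2πiv), so the assumption on v rules out
  -- poles there. The non-vanishing point is then found at a translate by M τ.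
  have hX : ee (m * τ - κ + (κ + v)) * ee (-(m * τ)) = ee v := by
    rw [← ee_add]; congr 1; ring
  have hnp : ∀ n : ℤ, ee (m * τ - κ + (κ + v)) * ee (-(m * τ)) * ee τ ^ n ≠ 1 := by
    rw [hX]; exact ee_mul_zpow_ne_one hv
  obtain ⟨M, hM⟩ := exists_hank_qSeq_ne_zero hp h0 (ee_ne_zero v) hQ (ee_ne_zero _) hnp
    (ee_mul_zpow_ne_one hv) k
  have hM' : ∀ n : ℤ, ee (m * τ - κ + (κ + v)) * ee τ ^ M * ee (-(m * τ)) * ee τ ^ n ≠ 1 := by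
    have := forall_mul_zpow h0 hnp M
    simpa only [zpow_natCast] using this
  have hz : ee (m * τ - κ + M * τ + (κ + v)) = ee (m * τ - κ + (κ + v)) * ee τ ^ M := by
    rw [← ee_nat_mul, ← ee_add]; congr 1; ring
  have hθ : ∀ u : ℂ, (∀ n : ℤ, ee (u + (κ + v)) * ee (-(m * τ)) * ee τ ^ n ≠ 1) →
      thetaProd (ee τ) (ee (u + (κ + v)) * (ee (-(m * τ)) * ee τ)) ≠ 0 := by
    intro u hu
    rw [← mul_assoc]
    exact thetaProd_ne_zero_of_forall hp h0 hQ (ee_ne_zero _) hu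
  have e1 := eventually_codiscrete_ne_zero (differentiable_thetaProd_ee hp hc (κ + v))
    (z := m * τ - κ + M * τ) (hθ _ (by rw [hz]; exact hM'))
  have e2 := eventually_codiscrete_ne_zero
    (differentiable_entireTau (w := ee v) hp h0 hQ (κ + v) k) (z := m * τ - κ + M * τ) (by
      rw [hz, entireTau_eq hp h0 hQ (mul_ne_zero (ee_ne_zero _) (pow_ne_zero M h0)) hM']
      refine mul_ne_zero (pow_ne_zero k ?_) hM
      rw [← hz, mul_assoc]
      exact hθ _ (by rw [hz]; exact hM'))
  filter_upwards [e1, e2] with u hu1 hu2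
  have hnu : ∀ n : ℤ, ee (u + (κ + v)) * ee (-(m * τ)) * ee τ ^ n ≠ 1 := by
    intro n hn
    refine hu1 (thetaProd_eq_zero hp h0 (mul_ne_zero (ee_ne_zero _) hc) (n := n - 1) ?_)
    rw [← hn, zpow_sub_one₀ h0]
    field_simp
  rw [entireTau_eq hp h0 hQ (ee_ne_zero _) hnu, ← add_assoc] at hu2
  refine ⟨?_, right_ne_zero_of_mul hu2⟩
  rw [notMem_lattice_iff, sub_eq_add_neg, ee_add, add_assoc]
  exact hnu

end Codiscrete

/-! ### The solution in terms of tau functions -/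

section Solution

open Complex

variable {τ v m u : ℂ}

theorem qpow_ne_zero (τ s : ℂ) : qpow τ s ≠ 0 := exp_ne_zero _

theorem qpow_add (τ s t : ℂ) : qpow τ (s + t) = qpow τ s * qpow τ t := by
  rw [qpow, qpow, qpow, ← exp_add]; congr 1; ring

theorem qpow_neg_natCast (τ : ℂ) (k : ℕ) : qpow τ (-((k : ℤ) : ℂ)) = (qpow τ 1 ^ k)⁻¹ := by
  rw [qpow, qpow, ← exp_nat_mul, ← exp_neg]; congr 1; push_cast; ring

theorem ee_eq_qpow_sq (τ : ℂ) : ee τ = qpow τ 1 ^ 2 := by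
  rw [ee, qpow, ← exp_nat_mul]; congr 1; push_cast; ring

theorem ee_pow_eq (τ : ℂ) (k : ℕ) : ee τ ^ k = (qpow τ 1 ^ k) ^ 2 := by
  rw [ee_eq_qpow_sq, ← pow_mul, ← pow_mul, mul_comm]

theorem ee_mul_qpow_sq (τ m : ℂ) : ee (-(m * τ)) * qpow τ m ^ 2 = 1 := by
  rw [ee, qpow, ← exp_nat_mul, ← exp_add, ← exp_zero]; congr 1; push_cast; ring

theorem ee_eq_exp_sq (u : ℂ) : ee u = exp (Real.pi * I * u) ^ 2 := by
  rw [ee, ← exp_nat_mul]; congr 1; push_cast; ring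

theorem ee_add_eq (τ u : ℂ) : ee (u + τ) = exp (Real.pi * I * u) ^ 2 * qpow τ 1 ^ 2 := by
  rw [ee_add, ee_eq_exp_sq u, ee_eq_qpow_sq]

theorem exp_add_eq (τ u : ℂ) :
    exp (Real.pi * I * (u + τ)) = exp (Real.pi * I * u) * qpow τ 1 := by
  rw [qpow, ← exp_add]; congr 1; ring

theorem contiguous_tauSeq (hτ : 0 < τ.im) (h : u + v - m * τ ∉ lattice τ) :
    Contiguous (ee τ) (ee (-(m * τ))) (ee u) (tauSeq τ v m (u - τ)) (tauSeq τ v m u)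
      (tauSeq τ v m (u + τ)) := by
  have hn : ∀ n : ℤ, ee (u - τ + v) * ee (-(m * τ)) * ee τ ^ n ≠ 1 := by
    rw [← ee_add]
    refine ee_mul_zpow_ne_one ?_
    convert sub_int_mul_notMem_lattice h (-1) using 2
    push_cast; ring
  have key := contiguous_qSeq (norm_ee_lt_one hτ) (ee_ne_zero τ) (ee_ne_zero v) (ee_ne_zero _)
    (ee_ne_zero _) hn
  have e1 : ee (u - τ + v) * ee τ = ee (u + v) := by rw [← ee_add]; congr 1; ring
  have e2 : ee (u + v) * ee τ = ee (u + τ + v) := by rw [← ee_add]; congr 1; ring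
  -- Here v drops out of the relations.
  have e3 : ee (u + v) / ee v = ee u := by rw [← ee_sub]; congr 1; ring
  rw [e1, e2, e3] at key
  exact key

theorem contiguous_tauSeq_add (hτ : 0 < τ.im) (h : u + v - m * τ ∉ lattice τ) :
    Contiguous (ee τ) (ee (-(m * τ))) (ee (u + τ)) (tauSeq τ v m u) (tauSeq τ v m (u + τ))
      (tauSeq τ v m (u + τ + τ)) := by
  have h' : u + τ + v - m * τ ∉ lattice τ := by
    convert sub_int_mul_notMem_lattice h 1 using 2
    push_cast; ring
  simpa using contiguous_tauSeq hτ h'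

theorem gauge_mul {K : Type*} [Field K] (r s : K) (n : ℕ) :
    gauge (r * s) n = gauge r n * gauge s n := by
  simp only [gauge, mul_pow, Finset.prod_mul_distrib]

theorem xiFactor_ne_zero (hτ : 0 < τ.im) (hv : v ∉ lattice τ) (m u : ℂ) (k : ℕ) :
    xiFactor τ v m u k ≠ 0 :=
  mul_ne_zero (pow_ne_zero _ (div_ne_zero (mul_ne_zero (exp_ne_zero _) (exp_ne_zero _))
    (theta_ne_zero hτ hv))) (gauge_ne_zero (exp_ne_zero _) _)

theorem xiFactor_add (τ v m u : ℂ) (k : ℕ) :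
    xiFactor τ v m (u + τ) k
      = xiFactor τ v m u k * (qpow τ m ^ k * gauge (qpow τ 1)⁻¹ k) := by
  have e1 : exp (Real.pi * I * m * (u + τ)) = exp (Real.pi * I * m * u) * qpow τ m := by
    rw [qpow, ← exp_add]; congr 1; ring
  have e2 : exp (-(Real.pi * I * (u + τ))) = exp (-(Real.pi * I * u)) * (qpow τ 1)⁻¹ := by
    rw [qpow, ← exp_neg, ← exp_add]; congr 1; ring
  rw [xiFactor, xiFactor, e1, e2, gauge_mul]
  ring

theorem xi_zero_eq (hτ : 0 < τ.im) (h : u + v - m * τ ∉ lattice τ) {n : ℤ} {k : ℕ}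
    (hn : n + 1 = k) : xi τ v u m n 0 = xiFactor τ v m u k * tau τ v m u k := by
  have := xi_eq (κ := 0) hτ hn (by simpa using h)
  simpa using this

theorem xi_one_eq (hτ : 0 < τ.im) (h : u + v - m * τ ∉ lattice τ) {n : ℤ} {k : ℕ}
    (hn : n + 1 = k) : xi τ v u m n 1
      = xiFactor τ v m u k * (qpow τ m ^ k * gauge (qpow τ 1)⁻¹ k) * tau τ v m (u + τ) k := by
  have h' : u + 1 * τ + v - m * τ ∉ lattice τ := by
    convert sub_int_mul_notMem_lattice h 1 using 2
    push_cast; ring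
  rw [xi_eq hτ hn h', one_mul, xiFactor_add]

theorem sub_one_notMem_lattice (h : u + v - m * τ ∉ lattice τ) :
    u + v - (m - 1) * τ ∉ lattice τ := by
  convert sub_int_mul_notMem_lattice h 1 using 2
  push_cast; ring

/-- The tau functions occurring in the solution do not vanish. -/
structure TauNeZero (τ v u m : ℂ) (k : ℕ) : Prop where
  not_pole : u + v - m * τ ∉ lattice τ
  succ_zero : tau τ v m u (k + 1) ≠ 0
  succ_one : tau τ v m (u + τ) (k + 1) ≠ 0
  zero : tau τ v m u k ≠ 0
  one : tau τ v m (u + τ) k ≠ 0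
  sub_zero : tau τ v (m - 1) u k ≠ 0
  sub_one : tau τ v (m - 1) (u + τ) k ≠ 0

theorem regular_iff (hτ : 0 < τ.im) (hv : v ∉ lattice τ) (k : ℕ) :
    Regular τ v u m k ↔ TauNeZero τ v u m k := by
  have hF := xiFactor_ne_zero hτ hv
  have hG : ∀ (m : ℂ) (k : ℕ), qpow τ m ^ k * gauge (qpow τ 1)⁻¹ k ≠ 0 := fun m k =>
    mul_ne_zero (pow_ne_zero _ (qpow_ne_zero _ _))
      (gauge_ne_zero (inv_ne_zero (qpow_ne_zero _ _)) _)
  have hk : (k : ℤ) + 1 = (k + 1 : ℕ) := by push_cast; ring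
  have hk' : (k : ℤ) - 1 + 1 = k := by ring
  have key : ∀ h : u + v - m * τ ∉ lattice τ,
      (∀ κ : Fin 2, xi τ v u m k (κ : ℕ) ≠ 0 ∧ xi τ v u m (k - 1) (κ : ℕ) ≠ 0 ∧
        xi τ v u (m - 1) (k - 1) (κ : ℕ) ≠ 0) ↔
      (tau τ v m u (k + 1) ≠ 0 ∧ tau τ v m u k ≠ 0 ∧ tau τ v (m - 1) u k ≠ 0) ∧
      (tau τ v m (u + τ) (k + 1) ≠ 0 ∧ tau τ v m (u + τ) k ≠ 0 ∧
        tau τ v (m - 1) (u + τ) k ≠ 0) := by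
    intro h
    have h' := sub_one_notMem_lattice h
    rw [Fin.forall_fin_two]
    simp only [Fin.val_zero, Fin.val_one, Nat.cast_zero, Nat.cast_one, xi_zero_eq hτ h hk,
      xi_zero_eq hτ h hk', xi_zero_eq hτ h' hk', xi_one_eq hτ h hk, xi_one_eq hτ h hk',
      xi_one_eq hτ h' hk', mul_ne_zero_iff_left (hF _ _ _),
      mul_ne_zero_iff_left (mul_ne_zero (hF _ _ _) (hG _ _))]
  constructor
  · rintro ⟨h, hx⟩
    obtain ⟨⟨h1, h2, h3⟩, h4, h5, h6⟩ := (key h).1 hx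
    exact ⟨h, h1, h4, h2, h5, h3, h6⟩
  · rintro ⟨h, h1, h4, h2, h5, h3, h6⟩
    exact ⟨h, (key h).2 ⟨⟨h1, h2, h3⟩, h4, h5, h6⟩⟩

theorem eventually_regular (hτ : 0 < τ.im) (hv : v ∉ lattice τ) (m : ℂ) (k : ℕ) :
    ∀ᶠ u in codiscrete ℂ, Regular τ v u m k := by
  have h := eventually_tau_ne_zero hτ hv
  filter_upwards [h m 0 (k + 1), h m τ (k + 1), h m 0 k, h m τ k, h (m - 1) 0 k,
    h (m - 1) τ k] with u h1 h2 h3 h4 h5 h6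
  simp only [add_zero] at h1 h3 h5
  exact (regular_iff hτ hv k).2 ⟨h1.1, h1.2, h2.2, h3.2, h4.2, h5.2, h6.2⟩

theorem sol_eq (hτ : 0 < τ.im) (hv : v ∉ lattice τ) {k : ℕ} (h : TauNeZero τ v u m k) :
    sol τ v u m k = tauVars (exp (Real.pi * I * u)) (qpow τ m) (qpow τ 1 ^ k)
      (tau τ v m u (k + 1)) (tau τ v m (u + τ) (k + 1)) (tau τ v m u k) (tau τ v m (u + τ) k)
      (tau τ v (m - 1) u k) (tau τ v (m - 1) (u + τ) k) := by
  have hk : (k : ℤ) + 1 = (k + 1 : ℕ) := by push_cast; ring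
  have hk' : (k : ℤ) - 1 + 1 = k := by ring
  have hq := qpow_ne_zero τ 1
  have ha := qpow_ne_zero τ (m - 1)
  have hg := gauge_ne_zero (inv_ne_zero hq) k
  have hm : qpow τ m = qpow τ (m - 1) * qpow τ 1 := by rw [← qpow_add, sub_add_cancel]
  have hF := xiFactor_ne_zero hτ hv
  have hF1 := hF m u (k + 1)
  have hF2 := hF m u k
  have hF3 := hF (m - 1) u k
  have h' := sub_one_notMem_lattice h.not_pole
  obtain ⟨h, h1, h2, h3, h4, h5, h6⟩ := h
  rw [sol, tauVars, qpow_neg_natCast, xi_zero_eq hτ h hk, xi_zero_eq hτ h hk',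
    xi_zero_eq hτ h' hk', xi_one_eq hτ h hk, xi_one_eq hτ h hk', xi_one_eq hτ h' hk', gauge_succ,
    hm]
  -- The common gauge factors cancel. In f₁ the sizes k + 1 and k leave q^m q^(-2k); in f₂ the
  -- indices m and m - 1 leave q^k.
  generalize gauge (qpow τ 1)⁻¹ k = g at hg ⊢
  congr 1
  · rw [inv_pow]
    field_simp
    ring
  · field_simp
    ring

end Solution

/-! ### The equations for the individual shifts -/

section Main

variable {τ v m u : ℂ} {k : ℕ}

theorem hank_sh_tauSeq (τ v m u : ℂ) (k : ℕ) :
    hank k (sh (tauSeq τ v m u)) = tau τ v (m - 1) u k := by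
  rw [sh_tauSeq, tau]

theorem hank_tauSeq (τ v m u : ℂ) (k : ℕ) : hank k (tauSeq τ v m u) = tau τ v m u k := rfl

theorem eqT_sol (hτ : 0 < τ.im) (hv : v ∉ lattice τ) (h : TauNeZero τ v u m k)
    (h' : TauNeZero τ v (u + τ) m k) :
    EqT (qpow τ 1) (sol τ v u m k) (sol τ v (u + τ) m k) := by
  have c₀ := contiguous_tauSeq hτ h.not_pole
  have c₁ := contiguous_tauSeq_add hτ h.not_pole
  have h0 := ee_ne_zero τ
  have hy := ee_ne_zero (u + τ)
  have hQ := ee_ne_zero (-(m * τ))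
  have e₁ := c₀.up_toda k
  have e₂ := c₁.up_down h0 hy hQ k
  have e₃ := c₁.down_up h0 hy hQ k
  have e₄ := c₁.both_size h0 hy hQ k
  simp only [hank_sh_tauSeq, hank_tauSeq, ee_pow_eq, ee_add_eq] at e₁ e₂ e₃ e₄
  -- As Q a² = 1 for a = q^m, multiplying the relations by a² removes Q.
  have hQa := ee_mul_qpow_sq τ m
  rw [sol_eq hτ hv h, sol_eq hτ hv h', exp_add_eq]
  apply eqT_tauVars (Complex.exp_ne_zero _) (qpow_ne_zero τ 1) (qpow_ne_zero τ m)
    (pow_ne_zero k (qpow_ne_zero τ 1)) h.succ_zero h.succ_one h'.succ_one h.zero h.one h'.one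
    h.sub_zero h.sub_one h'.sub_one e₁
  · linear_combination qpow τ m ^ 2 * e₂ - hQa * ((qpow τ 1 ^ k) ^ 2 *
      (tau τ v m (u + τ) k * tau τ v (m - 1) (u + τ) k
        - tau τ v m (u + τ + τ) k * tau τ v (m - 1) u k))
  · linear_combination qpow τ m ^ 2 * e₃ - hQa * (Complex.exp (Real.pi * Complex.I * u) ^ 2 *
      qpow τ 1 ^ 2 * ((qpow τ 1 ^ k) ^ 2 * (tau τ v m (u + τ) k * tau τ v (m - 1) (u + τ) k)
        - tau τ v m u k * tau τ v (m - 1) (u + τ + τ) k))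
  · linear_combination qpow τ m ^ 2 * e₄ - hQa * (Complex.exp (Real.pi * Complex.I * u) ^ 2 *
      qpow τ 1 ^ 2 * (qpow τ 1 ^ k) ^ 4 * tau τ v m u (k + 1) * tau τ v m (u + τ + τ) k)

theorem tau_up_size (hτ : 0 < τ.im) (h : u + v - m * τ ∉ lattice τ) (k : ℕ) :
    tau τ v (m - 1) u k * tau τ v m (u + τ) (k + 1)
        + Complex.exp (Real.pi * Complex.I * u) ^ 2 * tau τ v (m - 1) (u + τ) k
          * tau τ v m u (k + 1)
      = tau τ v m (u + τ) k * tau τ v (m - 1) u (k + 1) := by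
  have e := (contiguous_tauSeq hτ h).up_size k
  simpa only [hank_sh_tauSeq, hank_tauSeq, ee_eq_exp_sq] using e

theorem tau_down_size (hτ : 0 < τ.im) (h : u + v - m * τ ∉ lattice τ) (k : ℕ) :
    Complex.exp (Real.pi * Complex.I * u) ^ 2 * qpow τ 1 ^ 2 * (qpow τ 1 ^ k) ^ 4
        * tau τ v (m - 1) (u + τ) k * tau τ v m u (k + 1)
        + qpow τ m ^ 2 * (qpow τ 1 ^ k) ^ 2 * tau τ v (m - 1) u k * tau τ v m (u + τ) (k + 1)
      = qpow τ m ^ 2 * tau τ v m u k * tau τ v (m - 1) (u + τ) (k + 1) := by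
  have e := (contiguous_tauSeq_add hτ h).down_size (ee_ne_zero τ) (ee_ne_zero _) (ee_ne_zero _) k
  simp only [hank_sh_tauSeq, hank_tauSeq, ee_pow_eq, ee_add_eq] at e
  have hQa := ee_mul_qpow_sq τ m
  linear_combination qpow τ m ^ 2 * e - hQa * (Complex.exp (Real.pi * Complex.I * u) ^ 2 *
    qpow τ 1 ^ 2 * (qpow τ 1 ^ k) ^ 4 * tau τ v (m - 1) (u + τ) k * tau τ v m u (k + 1))

theorem tau_down_toda (hτ : 0 < τ.im) (h : u + v - m * τ ∉ lattice τ) (k : ℕ) :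
    qpow τ m ^ 2 * tau τ v m (u + τ) (k + 2) * tau τ v (m - 1) u k
      = Complex.exp (Real.pi * Complex.I * u) ^ 2 * qpow τ 1 ^ 2 * (qpow τ 1 ^ k) ^ 2 *
        ((qpow τ 1 ^ k) ^ 2 * qpow τ 1 ^ 2 * tau τ v m (u + τ) (k + 1) * tau τ v (m - 1) u (k + 1)
          - tau τ v m u (k + 1) * tau τ v (m - 1) (u + τ) (k + 1)) := by
  have e := (contiguous_tauSeq_add hτ h).down_toda (ee_ne_zero τ) (ee_ne_zero _) (ee_ne_zero _) k
  simp only [hank_sh_tauSeq, hank_tauSeq, ee_pow_eq, ee_add_eq] at e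
  have hQa := ee_mul_qpow_sq τ m
  have hb : (qpow τ 1 ^ k) ^ 2 ≠ 0 := pow_ne_zero 2 (pow_ne_zero k (qpow_ne_zero τ 1))
  apply mul_left_cancel₀ hb
  linear_combination qpow τ m ^ 2 * e + hQa * (Complex.exp (Real.pi * Complex.I * u) ^ 2 *
    qpow τ 1 ^ 2 * (qpow τ 1 ^ k) ^ 4 * ((qpow τ 1 ^ k) ^ 2 * qpow τ 1 ^ 2 *
      tau τ v m (u + τ) (k + 1) * tau τ v (m - 1) u (k + 1)
        - tau τ v m u (k + 1) * tau τ v (m - 1) (u + τ) (k + 1)))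

theorem shiftT₂_sol (τ v u m : ℂ) (k : ℕ) :
    ShiftT₂ (qpow τ 1) (sol τ v u m (k + 1)) (sol τ v u m k) := by
  refine ⟨rfl, rfl, ?_⟩
  simp only [sol]
  rw [← qpow_add]
  congr 1
  push_cast
  ring

theorem eqT₂_sol (hτ : 0 < τ.im) (hv : v ∉ lattice τ) (h : TauNeZero τ v u m k)
    (h' : TauNeZero τ v u m (k + 1)) :
    EqT₂ (sol τ v u m (k + 1 : ℕ)) (sol τ v u m k) := by
  rw [sol_eq hτ hv h, sol_eq hτ hv h', pow_succ]
  apply eqT₂_tauVars (Complex.exp_ne_zero _) (qpow_ne_zero τ 1) (qpow_ne_zero τ m)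
    (pow_ne_zero k (qpow_ne_zero τ 1)) h.succ_zero h.succ_one h.zero h.one
    h'.succ_zero h'.succ_one h'.sub_zero h'.sub_one (tau_up_size hτ h.not_pole k)
    (tau_down_size hτ h.not_pole k)
  · have e := (contiguous_tauSeq hτ h.not_pole).up_toda (k + 1)
    simp only [hankPred, hank_sh_tauSeq, hank_tauSeq] at e
    exact e
  · exact tau_down_toda hτ h.not_pole k

theorem eqT₂Inv_sol (hτ : 0 < τ.im) (hv : v ∉ lattice τ) (h : TauNeZero τ v u m k)
    (h' : TauNeZero τ v u m (k + 1)) :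
    EqT₂Inv (qpow τ 1) (sol τ v u m k) (sol τ v u m (k + 1 : ℕ)) := by
  rw [sol_eq hτ hv h, sol_eq hτ hv h', pow_succ]
  exact eqT₂Inv_tauVars (qpow_ne_zero τ 1) (qpow_ne_zero τ m)
    (pow_ne_zero k (qpow_ne_zero τ 1)) h.succ_zero h.succ_one h.zero h.one
    h.sub_zero h.sub_one h'.sub_zero h'.sub_one (tau_up_size hτ h.not_pole k)
    (tau_down_size hτ h.not_pole k)

theorem shiftT₁_sol (τ v u m : ℂ) (n : ℤ) :
    ShiftT₁ (qpow τ 1) (sol τ v u m n) (sol τ v u (m + 1) n) := by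
  refine ⟨rfl, ?_, rfl⟩
  simp only [sol]
  rw [qpow_add, neg_mul]

theorem ee_add_one_mul (τ m : ℂ) : ee (-((m + 1) * τ)) * ee τ = ee (-(m * τ)) := by
  rw [← ee_add]; congr 1; ring

theorem eqT₁_sol (hτ : 0 < τ.im) (hv : v ∉ lattice τ) (hm : qpow τ (2 * m) ≠ 1)
    (h : TauNeZero τ v u m k) (h' : TauNeZero τ v u (m + 1) k) :
    EqT₁ (sol τ v u m k) (sol τ v u (m + 1) k) := by
  have h0 := ee_ne_zero τ
  have hQ := ee_ne_zero (-(m * τ))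
  have hQ' := ee_ne_zero (-((m + 1) * τ))
  have c₀ := contiguous_tauSeq hτ h.not_pole
  have c₁ := contiguous_tauSeq_add hτ h.not_pole
  have g₀ := contiguous_tauSeq hτ h'.not_pole
  have g₁ := contiguous_tauSeq_add hτ h'.not_pole
  have e₁ := c₀.up_toda k
  have e₂ := c₁.up_down h0 (ee_ne_zero _) hQ k
  have e₃ := g₁.up_mul_down h0 (ee_ne_zero _) hQ' k
  have e₅ := c₀.down_up h0 (ee_ne_zero _) hQ k
  have e₆ := g₀.up_mul_down h0 (ee_ne_zero _) hQ' k
  simp only [hank_tauSeq, sh_tauSeq, ee_pow_eq, ee_eq_exp_sq u,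
    ee_add_one_mul, add_sub_cancel_right] at e₁ e₂ e₃ e₅ e₆
  have hQa := ee_mul_qpow_sq τ m
  have hm' : qpow τ m ^ 2 ≠ 1 := by
    rwa [two_mul, qpow_add, ← sq] at hm
  have e₄ : qpow τ m ^ 2 * (tau τ v m (u + τ) (k + 1) * hankPred k (tauSeq τ v m u))
      = Complex.exp (Real.pi * Complex.I * u) ^ 2 * (qpow τ 1 ^ k) ^ 2 *
        ((qpow τ 1 ^ k) ^ 2 * tau τ v m (u + τ) k * tau τ v (m - 1) u k
          - tau τ v m u k * tau τ v (m - 1) (u + τ) k) := by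
    -- For k = 0 both sides vanish; otherwise this is the downward Toda relation at one size less.
    cases k with
    | zero => simp [hankPred, tau, hank_zero]
    | succ k =>
      simp only [hankPred, hank_sh_tauSeq]
      linear_combination tau_down_toda hτ h.not_pole k
  rw [sol_eq hτ hv h, sol_eq hτ hv h', add_sub_cancel_right, qpow_add τ m 1]
  apply eqT₁_tauVars (Complex.exp_ne_zero _) (qpow_ne_zero τ m)
    (pow_ne_zero k (qpow_ne_zero τ 1)) hm' h.succ_zero h.succ_one h.zero h.one
    h.sub_zero h.sub_one h'.zero (X := hankPred k (tauSeq τ v m (u + τ)))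
    (B₂ := tau τ v m (u + τ + τ) k) (Bm := tau τ v m (u - τ) k) e₁ ?_ ?_ e₄ ?_ ?_
  · linear_combination qpow τ m ^ 2 * e₂ - hQa * ((qpow τ 1 ^ k) ^ 2 *
      (tau τ v m (u + τ) k * tau τ v (m - 1) (u + τ) k
        - tau τ v m (u + τ + τ) k * tau τ v (m - 1) u k))
  · linear_combination qpow τ m ^ 2 * e₃ - hQa * (tau τ v m (u + τ + τ) k * tau τ v m u k
      - tau τ v (m - 1) (u + τ) k * tau τ v (m + 1) (u + τ) k)
  · linear_combination qpow τ m ^ 2 * e₅ - hQa * (Complex.exp (Real.pi * Complex.I * u) ^ 2 *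
      ((qpow τ 1 ^ k) ^ 2 * (tau τ v m u k * tau τ v (m - 1) u k)
        - tau τ v m (u - τ) k * tau τ v (m - 1) (u + τ) k))
  · linear_combination qpow τ m ^ 2 * e₆ - hQa * (tau τ v m (u + τ) k * tau τ v m (u - τ) k
      - tau τ v (m - 1) u k * tau τ v (m + 1) u k)

theorem eqT₁Inv_sol (hτ : 0 < τ.im) (hv : v ∉ lattice τ)
    (h : TauNeZero τ v u m k) (h' : TauNeZero τ v u (m + 1) k) :
    EqT₁Inv (qpow τ 1) (sol τ v u (m + 1) k) (sol τ v u m k) := by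
  have e₁ := tau_up_size hτ h'.not_pole k
  have e₂ := tau_down_size hτ h'.not_pole k
  rw [add_sub_cancel_right, qpow_add τ m 1] at e₂
  rw [add_sub_cancel_right] at e₁
  rw [sol_eq hτ hv h, sol_eq hτ hv h', add_sub_cancel_right, qpow_add τ m 1]
  refine eqT₁Inv_tauVars (qpow_ne_zero τ 1) (qpow_ne_zero τ m)
    (pow_ne_zero k (qpow_ne_zero τ 1)) h.succ_zero h.zero h.one h'.succ_zero h'.zero h'.one e₁ ?_
  -- At m + 1 the parameter a becomes a q, so each term of `e₂` carries the factor q².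
  apply mul_left_cancel₀ (pow_ne_zero 2 (qpow_ne_zero τ 1))
  linear_combination e₂

end Main

end QPainleve

/-! ### Assembly of the theorem -/

theorem theorem1 (τ : ℂ) (hτ : 0 < τ.im) (v : ℂ) (hv : v ∉ QPainleve.lattice τ)
    (m : ℂ) (n : ℤ) (hn : 0 ≤ n) :
    (∀ᶠ u in Filter.codiscrete ℂ, QPainleve.Regular τ v u m n) ∧
    ∀ u : ℂ, QPainleve.Regular τ v u m n →
      (QPainleve.Regular τ v (u + τ) m n →
        QPainleve.EqT (QPainleve.qpow τ 1)
          (QPainleve.sol τ v u m n) (QPainleve.sol τ v (u + τ) m n)) ∧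
      (QPainleve.Regular τ v u (m + 1) n →
        QPainleve.ShiftT₁ (QPainleve.qpow τ 1)
          (QPainleve.sol τ v u m n) (QPainleve.sol τ v u (m + 1) n) ∧
        (QPainleve.qpow τ (2 * m) ≠ 1 →
          QPainleve.EqT₁ (QPainleve.sol τ v u m n) (QPainleve.sol τ v u (m + 1) n)) ∧
        QPainleve.EqT₁Inv (QPainleve.qpow τ 1)
          (QPainleve.sol τ v u (m + 1) n) (QPainleve.sol τ v u m n)) ∧
      (QPainleve.Regular τ v u m (n + 1) →
        QPainleve.ShiftT₂ (QPainleve.qpow τ 1)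
          (QPainleve.sol τ v u m (n + 1)) (QPainleve.sol τ v u m n) ∧
        QPainleve.EqT₂ (QPainleve.sol τ v u m (n + 1)) (QPainleve.sol τ v u m n) ∧
        QPainleve.EqT₂Inv (QPainleve.qpow τ 1)
          (QPainleve.sol τ v u m n) (QPainleve.sol τ v u m (n + 1))) := by
  obtain ⟨k, rfl⟩ := Int.eq_ofNat_of_zero_le hn
  have hk : (k : ℤ) + 1 = (k + 1 : ℕ) := by push_cast; ring
  simp only [hk, QPainleve.regular_iff hτ hv]
  refine ⟨?_, fun u h => ⟨QPainleve.eqT_sol hτ hv h, fun h' => ⟨QPainleve.shiftT₁_sol τ v u m k,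
    fun hm => QPainleve.eqT₁_sol hτ hv hm h h', QPainleve.eqT₁Inv_sol hτ hv h h'⟩,
    fun h' => ⟨QPainleve.shiftT₂_sol τ v u m k, QPainleve.eqT₂_sol hτ hv h h',
    QPainleve.eqT₂Inv_sol hτ hv h h'⟩⟩⟩
  simp only [← QPainleve.regular_iff hτ hv]
  exact QPainleve.eventually_regular hτ hv m k
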